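/- **Definitions.** A polynomial $f\in\mathbb R[x_1,\dots,x_n]$ is a *circuit polynomial* with outer exponents $\alpha(0),\dots,\alpha(r)$ and inner exponent $\beta$ ($r\le n$) if $f=\sum_{j=0}^r f_{\alpha(j)}x^{\alpha(j)}+f_\beta x^\beta$ with $f_{\alpha(j)}>0$ and $f_\beta\in\mathbb R$, where the Newton polytope $\mathrm{New}(f)$ is a simplex with vertices $\alpha(0),\dots,\alpha(r)\in(2\mathbb N)^n$ and $\beta=\sum_j\lambda_j\alpha(j)$ with all $\lambda_j>0$ and $\sum_j\lambda_j=1$. An exponent is called even if it lies in $(2\mathbb N)^n$, and odd otherwise. $C_{n,2d}$ is the cone of polynomials of degree at most $2d$ that are sums $\sum_i\mu_if_i$ with $\mu_i\ge 0$ and nonnegative circuit polynomials $f_i$. A *boundary* nonnegative circuit polynomial of degree $2d$ is a nonnegative circuit polynomial $f$ with $\deg f=2d$ that lies on the boundary of $C_{n,2d}$, the boundary being taken in the space of polynomials supported on the circuit $\{\alpha(0),\dots,\alpha(r),\beta\}$. $f$ is *degenerate* if it has infinitely many real zeros and $\mathrm{New}(f)$ is not $n$-dimensional. Let $\overline f=x_0^{2d}f(x_1/x_0,\dots,x_n/x_0)$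 be the homogenization, $\mathcal V(f)\subset\mathbb R^n$ and $\mathcal V(\overline f)\subset\mathbb P^n(\mathbb R)$ the sets of real zeros, and call the zeros of $\overline f$ with $x_0=0$ the zeros at infinity. **Theorem.** Let $f$ be a boundary nonnegative circuit polynomial of degree $2d$ in $n$ variables with inner exponent $\beta$. (1) Let $n=2$. (i) If $f$ has a constant term and is not degenerate, then $|\mathcal V(f)|=4$ and $|\mathcal V(\overline f)|\in\{4,5,6\}$ if $\beta$ is even, and $|\mathcal V(f)|=2$ and $|\mathcal V(\overline f)|\in\{2,3,4\}$ if $\beta$ is odd. (ii) If $f$ has no constant term, then either $|\mathcal V(f)|=|\mathcal V(\overline f)|=\infty$, or else $|\mathcal V(f)|=5$ and $|\mathcal V(\overline f)|\in\{5,6,7\}$ if $\beta$ is even, and $|\mathcal V(f)|=3$ and $|\mathcal V(\overline f)|\in\{3,4,5\}$ if $\beta$ is odd. In both cases, if $\mathcal V(f)$ is finite, then $\overline f$ has at most $2$ zeros at infinity. Each of the listed values of $|\mathcal V(\overline f)|$ in (i) and (ii), including the infinite case of (ii) for each parity of $\beta$, occurs for some such $f$ (of some degree) with $2$-dimensional Newton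 polytope. (2) Let $n>2$. Then $|\mathcal V(\overline f)|$ is $|\mathcal V(f)|$ plus the number of zeros at infinity. If $f$ has a constant term, then $\overline f$ has at most $3$ or infinitely many zeros at infinity. If $f$ has no constant term, then $\overline f$ has at most $2$ zeros at infinity, or it has infinitely many zeros (infinitely many at infinity, or infinitely many coming from $\mathcal V(f)$). For every $n>2$ all cases occur, for some degree and with $\mathcal V(f)$ finite and $\mathrm{New}(f)$ $n$-dimensional: exactly $0,1,2,3$ or infinitely many zeros at infinity with a constant term, and exactly $0,1,2$ or infinitely many without a constant term. -/

import Mathlib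

open MvPolynomial

noncomputable section

namespace CircuitZeros

variable {n : ℕ}

/-- An exponent vector, viewed as a point of `ℝⁿ`. -/
def toPoint (a : Fin n →₀ ℕ) : Fin n → ℝ := fun i => (a i : ℝ)

/-- An exponent is even if all its entries are even. -/
def IsEvenExp (a : Fin n →₀ ℕ) : Prop := ∀ i, Even (a i)

/-- The Newton polytope: the convex hull of the support. -/
def newtonPolytope (f : MvPolynomial (Fin n) ℝ) : Set (Fin n → ℝ) :=
  convexHull ℝ (toPoint '' (f.support : Set (Fin n →₀ ℕ)))

/-- The Newton polytope is `n`-dimensional. -/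
def IsFullDim (f : MvPolynomial (Fin n) ℝ) : Prop :=
  affineSpan ℝ (newtonPolytope f) = ⊤

/-- `f` is nonnegative on `ℝⁿ`. -/
def IsNonneg (f : MvPolynomial (Fin n) ℝ) : Prop := ∀ x : Fin n → ℝ, 0 ≤ eval x f

/-- `f` is a circuit polynomial with outer exponents `α 0, …, α r` and inner exponent `β`. -/
structure IsCircuit (f : MvPolynomial (Fin n) ℝ) (r : ℕ) (α : Fin (r + 1) → Fin n →₀ ℕ)
    (β : Fin n →₀ ℕ) : Prop where
  r_le : r ≤ n
  form : ∃ (c : Fin (r + 1) → ℝ) (b : ℝ), (∀ j, 0 < c j) ∧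
    f = ∑ j, monomial (α j) (c j) + monomial β b
  even : ∀ j, IsEvenExp (α j)
  simplex : AffineIndependent ℝ (fun j => toPoint (α j))
  newton : newtonPolytope f = convexHull ℝ (Set.range fun j => toPoint (α j))
  inner : ∃ w : Fin (r + 1) → ℝ, (∀ j, 0 < w j) ∧ ∑ j, w j = 1 ∧
    toPoint β = ∑ j, w j • toPoint (α j)

/-- `f` is a circuit polynomial. -/
def IsCircuitPolynomial (f : MvPolynomial (Fin n) ℝ) : Prop :=
  ∃ (r : ℕ) (α : Fin (r + 1) → Fin n →₀ ℕ) (β : Fin n →₀ ℕ), IsCircuit f r α β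

/-- The cone `C_{n,2d}` of sums of nonnegative circuit polynomials of degree at most `2d`. -/
def sonc (n d : ℕ) : Set (MvPolynomial (Fin n) ℝ) :=
  {p | p.totalDegree ≤ 2 * d ∧ ∃ k : ℕ, 0 < k ∧
    ∃ (μ : Fin k → ℝ) (g : Fin k → MvPolynomial (Fin n) ℝ),
      (∀ i, 0 ≤ μ i) ∧ (∀ i, IsCircuitPolynomial (g i) ∧ IsNonneg (g i)) ∧
      p = ∑ i, μ i • g i}

/-- The polynomial with support in `A` and the given coefficients. -/
def ofCoeffs (A : Finset (Fin n →₀ ℕ)) (c : A → ℝ) : MvPolynomial (Fin n) ℝ :=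
  ∑ a : A, monomial (a : Fin n →₀ ℕ) (c a)

/-- `f` lies on the boundary of the cone `C_{n,2d}` inside the space `ℝ^A` of the polynomials
supported on `A`. -/
def OnSoncBoundary (d : ℕ) (A : Finset (Fin n →₀ ℕ)) (f : MvPolynomial (Fin n) ℝ) : Prop :=
  (fun a : A => coeff (a : Fin n →₀ ℕ) f) ∈ frontier {c : A → ℝ | ofCoeffs A c ∈ sonc n d}

/-- `f` is a nonnegative circuit polynomial of degree `2d`, with outer exponents `α` and inner
exponent `β`, on the boundary of the SONC cone; the boundary is taken among the polynomials
supported on the circuit `{α 0, …, α r, β}`. -/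
structure IsBoundaryCircuit (d : ℕ) (f : MvPolynomial (Fin n) ℝ) (r : ℕ)
    (α : Fin (r + 1) → Fin n →₀ ℕ) (β : Fin n →₀ ℕ) : Prop where
  circuit : IsCircuit f r α β
  nonneg : IsNonneg f
  degree : f.totalDegree = 2 * d
  boundary : OnSoncBoundary d (insert β (Finset.univ.image α)) f

/-- `f` has a constant term. -/
def HasConstantTerm (f : MvPolynomial (Fin n) ℝ) : Prop := coeff 0 f ≠ 0

/-- The real zeros of `f` in `ℝⁿ`. -/
def affineZeros (f : MvPolynomial (Fin n) ℝ) : Set (Fin n → ℝ) := {v | eval v f = 0}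

/-- `f` is degenerate if it has infinitely many zeros and its Newton polytope is not
full-dimensional. -/
def IsDegenerate (f : MvPolynomial (Fin n) ℝ) : Prop :=
  (affineZeros f).Infinite ∧ ¬ IsFullDim f

/-- The homogenization `x₀^{2d} f(x₁/x₀, …, xₙ/x₀)` of a polynomial of degree at most `2d`. -/
def homogenization (d : ℕ) (f : MvPolynomial (Fin n) ℝ) : MvPolynomial (Fin (n + 1)) ℝ :=
  ∑ a ∈ f.support, monomial (Finsupp.cons (2 * d - a.degree) a) (coeff a f)

/-- The zeros in real projective `n`-space of a form in `n + 1` variables. -/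
def projZeros (F : MvPolynomial (Fin (n + 1)) ℝ) : Set (Projectivization ℝ (Fin (n + 1) → ℝ)) :=
  {P | eval P.rep F = 0}

/-- The projective zeros with `v₀ = 0`. -/
def zerosAtInfinity (F : MvPolynomial (Fin (n + 1)) ℝ) :
    Set (Projectivization ℝ (Fin (n + 1) → ℝ)) :=
  {P | P ∈ projZeros F ∧ P.rep 0 = 0}

/-- A boundary nonnegative circuit polynomial in `n` variables with full-dimensional Newton
polytope, of some degree `2d`, has the property `Q d f β`. -/
def Occurs (n : ℕ) (Q : ℕ → MvPolynomial (Fin n) ℝ → (Fin n →₀ ℕ) → Prop) : Prop :=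
  ∃ (d : ℕ) (f : MvPolynomial (Fin n) ℝ) (r : ℕ) (α : Fin (r + 1) → Fin n →₀ ℕ)
    (β : Fin n →₀ ℕ), IsBoundaryCircuit d f r α β ∧ IsFullDim f ∧ Q d f β

end CircuitZeros

end

/-! Everything rests on the weighted AM-GM inequality. With barycentric weights w of β, it gives
|x^β| ≤ ∑ w_j x^{α(j)} (`abs_mon_beta_le`), with equality exactly when all outer monomials agree.
Affine independence allows a positive rescaling of the variables that makes the outer coefficients
proportional to w (`exists_equalizer`). Nonnegativity then bounds the coefficient of x^β, from both
sides if β is odd. Were no bound attained, all nearby coefficient vectors would still give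
nonnegative circuit polynomials. So a boundary polynomial is, up to scaling, ∑ w_j x^{α(j)} - ε x^β
with ε = ±1, and ε = 1 if β is even (`exists_normalForm`).

Zeros off the coordinate hyperplanes are the equality cases of AM-GM. If r < n, some linear form is
constant on the simplex, and exponentiating it gives a curve of zeros. If r = n, taking logarithms
forces all |x_i| = 1 after rescaling, so these zeros are the sign vectors s with s^β = ε: for n = 2
there are 4 or 2, according to the parity of β. For r = n, a point with a zero coordinate is a zero
iff all outer monomials vanish there. This never happens with a constant term. Without one, it
happens only at the origin if every axis carries an outer exponent, and otherwise along a whole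
axis.

At infinity, once some outer exponent has degree below 2d, so has β, and the zeros are the common
zeros of the outer monomials of degree 2d (`eval_at_infinity_iff`). If some pair of coordinates
supports no such monomial, a projective line contributes infinitely many. Otherwise only coordinate
points remain, namely those i with no pure top power (`encard_zerosAtInfinity`). If there are s of
these, every pair of them needs its own exponent and each of the n - s other coordinates needs a
pure power. With a constant term this leaves (n - s) + C(s,2) ≤ r ≤ n, so s ≤ 3. Without one, if r =
n and all axes carry exponents, n + C(s,2) ≤ n + 1, so s ≤ 2.

The examples are dilated lattice simplices: small triangles and tetrahedra, carried to higher
dimension by pyramids that preserve all the relevant data. -/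

noncomputable section

namespace CircuitZeros

section

variable {n r : ℕ}

/-! ### Affine independence of exponents -/

/-- The matrix whose rows are the points `(1, α j)`. -/
def liftedMatrix (α : Fin (r + 1) → Fin n →₀ ℕ) : Matrix (Fin (r + 1)) (Fin (n + 1)) ℝ :=
  Matrix.of fun j => Fin.cons 1 (toPoint (α j))

lemma liftedMatrix_mulVec (α : Fin (r + 1) → Fin n →₀ ℕ) (h : ℝ) (l : Fin n → ℝ)
    (j : Fin (r + 1)) :
    (liftedMatrix α).mulVec (Fin.cons h l) j = h + ∑ i, (α j i : ℝ) * l i := by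
  simp [liftedMatrix, Matrix.mulVec, dotProduct, Fin.sum_univ_succ, toPoint]

lemma affineIndependent_toPoint_iff (α : Fin (r + 1) → Fin n →₀ ℕ) :
    AffineIndependent ℝ (fun j => toPoint (α j)) ↔
      ∀ u : Fin (r + 1) → ℝ, ∑ j, u j = 0 → (∀ i, ∑ j, u j * α j i = 0) → u = 0 := by
  rw [affineIndependent_iff]
  constructor
  · intro h u hu hs
    funext j
    refine h Finset.univ u hu ?_ j (Finset.mem_univ j)
    funext i
    simpa [toPoint] using hs i
  · intro h s u hu hs e he
    classical
    have := h (fun j => if j ∈ s then u j else 0) (by simpa using hu) (fun i => by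
      have := congrFun hs i
      simpa [toPoint] using this)
    simpa [he] using congrFun this e

/-- The leading 1 in each row records that the coefficients of an affine relation sum to zero. -/
lemma linearIndependent_liftedMatrix {α : Fin (r + 1) → Fin n →₀ ℕ}
    (hα : AffineIndependent ℝ (fun j => toPoint (α j))) :
    LinearIndependent ℝ (liftedMatrix α).row := by
  rw [Fintype.linearIndependent_iff]
  intro u hu
  have h0 := congrFun hu 0
  refine congrFun ((affineIndependent_toPoint_iff α).1 hα u ?_ fun i => ?_)
  · simpa [liftedMatrix, Matrix.row] using h0
  · have := congrFun hu i.succ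
    simpa [liftedMatrix, Matrix.row, toPoint] using this

lemma liftedMatrix_surjective {α : Fin (r + 1) → Fin n →₀ ℕ}
    (hα : AffineIndependent ℝ (fun j => toPoint (α j))) :
    Function.Surjective (liftedMatrix α).mulVecLin := by
  rw [← LinearMap.range_eq_top]
  apply Submodule.eq_top_of_finrank_eq
  have := (linearIndependent_liftedMatrix hα).rank_matrix
  rw [Matrix.rank] at this
  simpa using this

/-- Every function on affinely independent points is affine. -/
lemma exists_affine_interpolation {α : Fin (r + 1) → Fin n →₀ ℕ}
    (hα : AffineIndependent ℝ (fun j => toPoint (α j))) (t : Fin (r + 1) → ℝ) :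
    ∃ (h : ℝ) (l : Fin n → ℝ), ∀ j, h + ∑ i, (α j i : ℝ) * l i = t j := by
  obtain ⟨v, hv⟩ := liftedMatrix_surjective hα t
  refine ⟨v 0, Fin.tail v, fun j => ?_⟩
  rw [← liftedMatrix_mulVec, Fin.cons_self_tail, ← hv, Matrix.mulVecLin_apply]

/-- A linear form that is constant on a full-dimensional simplex vanishes. -/
lemma eq_zero_of_constant {α : Fin (n + 1) → Fin n →₀ ℕ}
    (hα : AffineIndependent ℝ (fun j => toPoint (α j))) {l : Fin n → ℝ} {h : ℝ}
    (hl : ∀ j, ∑ i, (α j i : ℝ) * l i = h) : l = 0 := by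
  -- For r = n the lifted matrix is square, so surjectivity gives injectivity.
  have hinj := (LinearMap.injective_iff_surjective_of_finrank_eq_finrank (by simp)).2
    (liftedMatrix_surjective hα)
  have : (Fin.cons (-h) l : Fin (n + 1) → ℝ) = 0 := by
    apply hinj
    funext j
    rw [Matrix.mulVecLin_apply, liftedMatrix_mulVec, hl j]
    simp
  funext i
  simpa using congrFun this i.succ

/-- A lower-dimensional simplex admits a nonzero linear form that is constant on it. -/
lemma exists_constant_ne_zero (hr : r < n) (α : Fin (r + 1) → Fin n →₀ ℕ) :
    ∃ (l : Fin n → ℝ) (h : ℝ), l ≠ 0 ∧ ∀ j, ∑ i, (α j i : ℝ) * l i = h := by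
  -- There are n + 1 columns but only r + 1 < n + 1 rows.
  have hker : (liftedMatrix α).mulVecLin.ker ≠ ⊥ :=
    LinearMap.ker_ne_bot_of_finrank_lt (by simpa using hr)
  obtain ⟨v, hv, hv0⟩ := Submodule.exists_mem_ne_zero_of_ne_bot hker
  have key : ∀ j, v 0 + ∑ i, (α j i : ℝ) * Fin.tail v i = 0 := by
    intro j
    rw [← liftedMatrix_mulVec, Fin.cons_self_tail]
    exact congrFun (LinearMap.mem_ker.1 hv) j
  refine ⟨Fin.tail v, -v 0, fun h0 => hv0 ?_, fun j => by linarith [key j]⟩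
  have h1 : v 0 = 0 := by simpa [h0] using key 0
  rw [← Fin.cons_self_tail v, h0, h1]
  funext i
  refine Fin.cases ?_ (fun i => ?_) i <;> simp

/-! ### Monomials as functions -/

/-- The monomial function `x ↦ x^a`. -/
def mon (a : Fin n →₀ ℕ) (x : Fin n → ℝ) : ℝ := ∏ i, x i ^ a i

lemma eval_monomial_eq (a : Fin n →₀ ℕ) (c : ℝ) (x : Fin n → ℝ) :
    eval x (monomial a c) = c * mon a x := by
  rw [eval_monomial, Finsupp.prod_fintype _ _ (by simp), mon]

lemma mon_mul (a : Fin n →₀ ℕ) (x y : Fin n → ℝ) :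
    mon a (fun i => x i * y i) = mon a x * mon a y := by
  simp [mon, mul_pow, Finset.prod_mul_distrib]

lemma mon_eq_zero_iff (a : Fin n →₀ ℕ) (x : Fin n → ℝ) :
    mon a x = 0 ↔ ∃ i, x i = 0 ∧ a i ≠ 0 := by
  simp [mon, Finset.prod_eq_zero_iff]

lemma mon_pos (a : Fin n →₀ ℕ) {x : Fin n → ℝ} (hx : ∀ i, 0 < x i) : 0 < mon a x :=
  Finset.prod_pos fun i _ => pow_pos (hx i) _

lemma mon_abs (a : Fin n →₀ ℕ) (x : Fin n → ℝ) : mon a (fun i => |x i|) = |mon a x| := by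
  simp [mon, Finset.abs_prod]

lemma mon_nonneg_of_even {a : Fin n →₀ ℕ} (ha : IsEvenExp a) (x : Fin n → ℝ) : 0 ≤ mon a x :=
  Finset.prod_nonneg fun i _ => (ha i).pow_nonneg _

lemma mon_smul (a : Fin n →₀ ℕ) (t : ℝ) (x : Fin n → ℝ) :
    mon a (t • x) = t ^ a.degree * mon a x := by
  simp [mon, mul_pow, Finset.prod_mul_distrib, Finset.prod_pow_eq_pow_sum,
    Finsupp.degree_eq_sum]

lemma mon_exp (a : Fin n →₀ ℕ) (l : Fin n → ℝ) :
    mon a (fun i => Real.exp (l i)) = Real.exp (∑ i, (a i : ℝ) * l i) := by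
  simp [mon, Real.exp_sum, Real.exp_nat_mul]

/-! ### Circuits -/

/-- `α` are the vertices of an even simplex and `β` its point with barycentric coordinates
`w > 0`. -/
structure IsSimplexPoint (α : Fin (r + 1) → Fin n →₀ ℕ) (β : Fin n →₀ ℕ)
    (w : Fin (r + 1) → ℝ) : Prop where
  even : ∀ j, IsEvenExp (α j)
  simplex : AffineIndependent ℝ (fun j => toPoint (α j))
  pos : ∀ j, 0 < w j
  sum : ∑ j, w j = 1
  bary : ∀ i, (β i : ℝ) = ∑ j, w j * α j i

/-- The polynomial `∑ c_j x^{α(j)} + b x^β`. -/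
def circuitPoly (α : Fin (r + 1) → Fin n →₀ ℕ) (β : Fin n →₀ ℕ) (c : Fin (r + 1) → ℝ) (b : ℝ) :
    MvPolynomial (Fin n) ℝ :=
  ∑ j, monomial (α j) (c j) + monomial β b

variable {α : Fin (r + 1) → Fin n →₀ ℕ} {β : Fin n →₀ ℕ} {w : Fin (r + 1) → ℝ}

lemma eval_circuitPoly (c : Fin (r + 1) → ℝ) (b : ℝ) (x : Fin n → ℝ) :
    eval x (circuitPoly α β c b) = ∑ j, c j * mon (α j) x + b * mon β x := by
  simp [circuitPoly, eval_monomial_eq]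

lemma injective_of_affineIndependent
    (h : AffineIndependent ℝ (fun j => toPoint (α j))) : Function.Injective α := by
  intro j k hjk
  exact h.injective (by simp [hjk])

namespace IsSimplexPoint

/-- Otherwise w and the indicator of k would both be barycentric coordinates of β; uniqueness then
kills the other weights, which are positive. -/
lemma beta_ne (h : IsSimplexPoint α β w) (hr : 0 < r) (k : Fin (r + 1)) : α k ≠ β := by
  intro hk
  have := (affineIndependent_toPoint_iff α).1 h.simplex (fun j => w j - if j = k then 1 else 0)
    (by simp [h.sum]) (fun i => by
      simp only [sub_mul, Finset.sum_sub_distrib, ite_mul, one_mul, zero_mul]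
      rw [← h.bary i, ← hk]
      simp)
  have hne : ∃ j, j ≠ k := by
    have : Nontrivial (Fin (r + 1)) := Fin.nontrivial_iff_two_le.2 (by omega)
    exact exists_ne k
  obtain ⟨j, hj⟩ := hne
  have h1 := congrFun this j
  simp [hj] at h1
  exact (h.pos j).ne' h1

lemma coeff_alpha (h : IsSimplexPoint α β w) (hr : 0 < r) (c : Fin (r + 1) → ℝ) (b : ℝ)
    (k : Fin (r + 1)) : coeff (α k) (circuitPoly α β c b) = c k := by
  classical
  have hinj := injective_of_affineIndependent h.simplex
  simp only [circuitPoly, coeff_add, coeff_sum, coeff_monomial, hinj.eq_iff,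
    if_neg (h.beta_ne hr k).symm]
  simp

lemma coeff_beta (h : IsSimplexPoint α β w) (hr : 0 < r) (c : Fin (r + 1) → ℝ) (b : ℝ) :
    coeff β (circuitPoly α β c b) = b := by
  classical
  simp [circuitPoly, coeff_sum, coeff_monomial, h.beta_ne hr]

lemma support_subset (c : Fin (r + 1) → ℝ) (b : ℝ) {a : Fin n →₀ ℕ}
    (ha : a ∈ (circuitPoly α β c b).support) : a = β ∨ ∃ j, a = α j := by
  classical
  rw [mem_support_iff] at ha
  by_contra! hcon
  apply ha
  simp [circuitPoly, coeff_sum, coeff_monomial, hcon.1.symm, fun j => (hcon.2 j).symm]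

lemma toPoint_beta (h : IsSimplexPoint α β w) : toPoint β = ∑ j, w j • toPoint (α j) := by
  funext i
  simp [toPoint, h.bary i]

lemma newton_eq (h : IsSimplexPoint α β w) (hr : 0 < r) {c : Fin (r + 1) → ℝ}
    (hc : ∀ j, 0 < c j) (b : ℝ) :
    newtonPolytope (circuitPoly α β c b) = convexHull ℝ (Set.range fun j => toPoint (α j)) := by
  apply Set.Subset.antisymm
  · apply convexHull_min _ (convex_convexHull ℝ _)
    rintro _ ⟨a, ha, rfl⟩
    rcases support_subset c b ha with rfl | ⟨j, rfl⟩
    · rw [h.toPoint_beta]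
      exact (convex_convexHull ℝ _).sum_mem (fun j _ => (h.pos j).le) h.sum
        fun j _ => subset_convexHull ℝ _ ⟨j, rfl⟩
    · exact subset_convexHull ℝ _ ⟨j, rfl⟩
  · apply convexHull_mono
    rintro _ ⟨j, rfl⟩
    refine ⟨α j, ?_, rfl⟩
    rw [Finset.mem_coe, mem_support_iff, h.coeff_alpha hr]
    exact (hc j).ne'

lemma r_le (h : IsSimplexPoint α β w) : r ≤ n := by
  have h1 := h.simplex.card_le_finrank_succ
  have h2 := (vectorSpan ℝ (Set.range fun j => toPoint (α j))).finrank_le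
  simp only [Fintype.card_fin, Module.finrank_fintype_fun_eq_card] at h1 h2
  omega

lemma isCircuit (h : IsSimplexPoint α β w) (hr : 0 < r) {c : Fin (r + 1) → ℝ}
    (hc : ∀ j, 0 < c j) (b : ℝ) : IsCircuit (circuitPoly α β c b) r α β where
  r_le := h.r_le
  form := ⟨c, b, hc, rfl⟩
  even := h.even
  simplex := h.simplex
  newton := h.newton_eq hr hc b
  inner := ⟨w, h.pos, h.sum, h.toPoint_beta⟩

/-- The degree of the inner exponent, as a convex combination. -/
lemma degree_beta (h : IsSimplexPoint α β w) :
    (β.degree : ℝ) = ∑ j, w j * (α j).degree := by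
  simp only [Finsupp.degree_eq_sum, Nat.cast_sum, h.bary, Finset.mul_sum]
  exact Finset.sum_comm

lemma degree_beta_le (h : IsSimplexPoint α β w) {D : ℕ} (hD : ∀ j, (α j).degree ≤ D) :
    β.degree ≤ D := by
  have : (β.degree : ℝ) ≤ D := by
    rw [h.degree_beta, ← one_mul (D : ℝ), ← h.sum, Finset.sum_mul]
    exact Finset.sum_le_sum fun j _ =>
      mul_le_mul_of_nonneg_left (by exact_mod_cast hD j) (h.pos j).le
  exact_mod_cast this

lemma degree_beta_lt (h : IsSimplexPoint α β w) {D : ℕ} (hD : ∀ j, (α j).degree ≤ D)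
    (k : Fin (r + 1)) (hk : (α k).degree < D) : β.degree < D := by
  have : (β.degree : ℝ) < D := by
    rw [h.degree_beta, ← one_mul (D : ℝ), ← h.sum, Finset.sum_mul]
    exact Finset.sum_lt_sum (fun j _ =>
      mul_le_mul_of_nonneg_left (by exact_mod_cast hD j) (h.pos j).le)
      ⟨k, Finset.mem_univ k, mul_lt_mul_of_pos_left (by exact_mod_cast hk) (h.pos k)⟩
  exact_mod_cast this

/-- If a coordinate of the inner exponent vanishes, so do those of the outer exponents. -/
lemma alpha_eq_zero (h : IsSimplexPoint α β w) {i : Fin n} (hi : β i = 0) (j : Fin (r + 1)) :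
    α j i = 0 := by
  have hs := h.bary i
  rw [hi, Nat.cast_zero, eq_comm, Finset.sum_eq_zero_iff_of_nonneg
    (fun j _ => mul_nonneg (h.pos j).le (Nat.cast_nonneg _))] at hs
  have := hs j (Finset.mem_univ j)
  simpa [(h.pos j).ne'] using this

/-- The monomial of the inner exponent as a weighted geometric mean. -/
lemma mon_beta_eq (h : IsSimplexPoint α β w) {y : Fin n → ℝ} (hy : ∀ i, 0 ≤ y i) :
    ∏ j, mon (α j) y ^ w j = mon β y := by
  have h1 : ∀ j, mon (α j) y ^ w j = ∏ i, y i ^ (w j * α j i) := by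
    intro j
    rw [mon, ← Real.finsetProd_rpow _ _ fun i _ => pow_nonneg (hy i) _]
    refine Finset.prod_congr rfl fun i _ => ?_
    rw [mul_comm, Real.rpow_mul (hy i), Real.rpow_natCast]
  simp only [h1]
  rw [Finset.prod_comm, mon]
  refine Finset.prod_congr rfl fun i _ => ?_
  rw [← Real.rpow_sum_of_nonneg (hy i)
    fun j _ => mul_nonneg (h.pos j).le (Nat.cast_nonneg _), ← h.bary i, Real.rpow_natCast]

lemma abs_mon_alpha (h : IsSimplexPoint α β w) (j : Fin (r + 1)) (y : Fin n → ℝ) :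
    |mon (α j) y| = mon (α j) y := abs_of_nonneg (mon_nonneg_of_even (h.even j) y)

lemma prod_mon_alpha (h : IsSimplexPoint α β w) (y : Fin n → ℝ) :
    ∏ j, mon (α j) y ^ w j = |mon β y| := by
  rw [← mon_abs, ← h.mon_beta_eq fun i => abs_nonneg _]
  simp only [mon_abs, h.abs_mon_alpha]

/-- Weighted AM-GM for the numbers y^{α(j)}, nonnegative because the α(j) are even; their weighted
geometric mean is |y^β|. -/
lemma abs_mon_beta_le (h : IsSimplexPoint α β w) (y : Fin n → ℝ) :
    |mon β y| ≤ ∑ j, w j * mon (α j) y := by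
  rw [← h.prod_mon_alpha y]
  exact Real.geom_mean_le_arith_mean_weighted _ _ _ (fun j _ => (h.pos j).le) h.sum
    fun j _ => mon_nonneg_of_even (h.even j) y

lemma abs_mon_beta_eq_iff (h : IsSimplexPoint α β w) (y : Fin n → ℝ) :
    |mon β y| = ∑ j, w j * mon (α j) y ↔ ∀ j k, mon (α j) y = mon (α k) y := by
  rw [← h.prod_mon_alpha y, Real.geom_mean_eq_arith_mean_weighted_iff_of_pos _ _ _
    (fun j _ => h.pos j) h.sum fun j _ => mon_nonneg_of_even (h.even j) y]
  simp

/-- Rescaling the variables makes the outer coefficients proportional to the weights. -/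
lemma exists_equalizer (h : IsSimplexPoint α β w) {c : Fin (r + 1) → ℝ} (hc : ∀ j, 0 < c j) :
    ∃ (p : Fin n → ℝ) (K : ℝ), (∀ i, 0 < p i) ∧ 0 < K ∧ ∀ j, c j * mon (α j) p = w j * K := by
  -- In logarithmic coordinates the condition on p is affine in α(j): the linear part l gives p =
  -- exp l, and the constant s gives K = exp(-s).
  obtain ⟨s, l, hl⟩ := exists_affine_interpolation h.simplex fun j => Real.log (w j / c j)
  refine ⟨fun i => Real.exp (l i), Real.exp (-s), fun i => Real.exp_pos _, Real.exp_pos _,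
    fun j => ?_⟩
  have hcj := hc j
  rw [mon_exp, show ∑ i, (α j i : ℝ) * l i = Real.log (w j / c j) + -s by linarith [hl j],
    Real.exp_add, Real.exp_log (div_pos (h.pos j) hcj)]
  field_simp

end IsSimplexPoint

end

section

variable {n r d : ℕ} {α : Fin (r + 1) → Fin n →₀ ℕ} {β : Fin n →₀ ℕ} {w : Fin (r + 1) → ℝ}

/-! ### The boundary of the SONC cone -/

lemma totalDegree_le_of_degree_le {f : MvPolynomial (Fin n) ℝ} {D : ℕ}
    (h : ∀ a ∈ f.support, a.degree ≤ D) : f.totalDegree ≤ D :=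
  Finset.sup_le fun a ha => h a ha

lemma degree_le_totalDegree {f : MvPolynomial (Fin n) ℝ} {a : Fin n →₀ ℕ} (h : a ∈ f.support) :
    a.degree ≤ f.totalDegree := le_totalDegree h

lemma mem_sonc {f : MvPolynomial (Fin n) ℝ} (hdeg : f.totalDegree ≤ 2 * d)
    (hf : IsCircuitPolynomial f) (hnn : IsNonneg f) : f ∈ sonc n d :=
  ⟨hdeg, 1, one_pos, fun _ => 1, fun _ => f, fun _ => zero_le_one, fun _ => ⟨hf, hnn⟩, by simp⟩

lemma isNonneg_of_mem_sonc {f : MvPolynomial (Fin n) ℝ} (hf : f ∈ sonc n d) : IsNonneg f := by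
  obtain ⟨-, k, -, μ, g, hμ, hg, rfl⟩ := hf
  intro x
  rw [map_sum]
  exact Finset.sum_nonneg fun i _ => by
    rw [smul_eval]
    exact mul_nonneg (hμ i) ((hg i).2 x)

lemma coeff_ofCoeffs (A : Finset (Fin n →₀ ℕ)) (c : A → ℝ) {m : Fin n →₀ ℕ} (hm : m ∈ A) :
    coeff m (ofCoeffs A c) = c ⟨m, hm⟩ := by
  classical
  rw [ofCoeffs, coeff_sum, Finset.sum_eq_single ⟨m, hm⟩]
  · simp
  · rintro a - ha
    rw [coeff_monomial, if_neg fun h => ha (Subtype.ext h)]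
  · simp

lemma coeff_ofCoeffs_of_notMem (A : Finset (Fin n →₀ ℕ)) (c : A → ℝ) {m : Fin n →₀ ℕ}
    (hm : m ∉ A) : coeff m (ofCoeffs A c) = 0 := by
  classical
  rw [ofCoeffs, coeff_sum, Finset.sum_eq_zero]
  rintro a -
  rw [coeff_monomial, if_neg]
  rintro rfl
  exact hm a.2

/-- The exponents of a circuit. -/
abbrev exps (α : Fin (r + 1) → Fin n →₀ ℕ) (β : Fin n →₀ ℕ) : Finset (Fin n →₀ ℕ) :=
  insert β (Finset.univ.image α)

/-- The inner exponent as an element of the circuit. -/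
def innerExp (α : Fin (r + 1) → Fin n →₀ ℕ) (β : Fin n →₀ ℕ) : exps α β :=
  ⟨β, Finset.mem_insert_self _ _⟩

/-- An outer exponent as an element of the circuit. -/
def outerExp (α : Fin (r + 1) → Fin n →₀ ℕ) (β : Fin n →₀ ℕ) (j : Fin (r + 1)) : exps α β :=
  ⟨α j, Finset.mem_insert_of_mem (Finset.mem_image_of_mem _ (Finset.mem_univ j))⟩

lemma IsSimplexPoint.ofCoeffs_eq (h : IsSimplexPoint α β w) (hr : 0 < r) (c : exps α β → ℝ) :
    ofCoeffs (exps α β) c =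
      circuitPoly α β (fun j => c (outerExp α β j)) (c (innerExp α β)) := by
  ext m
  by_cases hm : m ∈ exps α β
  · rw [coeff_ofCoeffs _ _ hm]
    rcases Finset.mem_insert.1 hm with rfl | hm'
    · rw [h.coeff_beta hr]; rfl
    · obtain ⟨j, -, rfl⟩ := Finset.mem_image.1 hm'
      rw [h.coeff_alpha hr]; rfl
  · rw [coeff_ofCoeffs_of_notMem _ _ hm]
    by_contra hne
    rcases IsSimplexPoint.support_subset _ _ (mem_support_iff.2 (Ne.symm hne)) with rfl | ⟨j, rfl⟩
    · exact hm (Finset.mem_insert_self _ _)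
    · exact hm (outerExp α β j).2

lemma IsSimplexPoint.totalDegree_le (h : IsSimplexPoint α β w) {D : ℕ}
    (hD : ∀ j, (α j).degree ≤ D) (c : Fin (r + 1) → ℝ) (b : ℝ) :
    (circuitPoly α β c b).totalDegree ≤ D := by
  refine totalDegree_le_of_degree_le fun a ha => ?_
  rcases IsSimplexPoint.support_subset c b ha with rfl | ⟨j, rfl⟩
  exacts [h.degree_beta_le hD, hD j]

lemma IsCircuit.exists_simplexPoint {f : MvPolynomial (Fin n) ℝ} (hf : IsCircuit f r α β) :
    ∃ (w c : Fin (r + 1) → ℝ) (b : ℝ), IsSimplexPoint α β w ∧ (∀ j, 0 < c j) ∧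
      f = circuitPoly α β c b := by
  obtain ⟨c, b, hc, hfc⟩ := hf.form
  obtain ⟨w, hw, hw1, hβ⟩ := hf.inner
  refine ⟨w, c, b, ⟨hf.even, hf.simplex, hw, hw1, fun i => ?_⟩, hc, hfc⟩
  simpa [toPoint] using congrFun hβ i

/-- A monomial square is an interior point of the cone. -/
lemma IsBoundaryCircuit.r_pos {f : MvPolynomial (Fin n) ℝ} (hf : IsBoundaryCircuit d f r α β) :
    0 < r := by
  by_contra hr
  obtain rfl : r = 0 := by omega
  obtain ⟨w, c, b, h, hc, rfl⟩ := hf.circuit.exists_simplexPoint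
  have hw : w 0 = 1 := by simpa using h.sum
  have hαβ : ∀ j, α j = β := by
    intro j
    rw [Fin.fin_one_eq_zero j]
    ext i
    have := h.bary i
    simp only [Nat.reduceAdd, Finset.univ_unique, Fin.default_eq_zero, Fin.isValue,
      Finset.sum_singleton, hw, one_mul, Nat.cast_inj] at this
    exact this.symm
  have hmonomial : ∀ (c : Fin (0 + 1) → ℝ) (b : ℝ),
      circuitPoly α β c b = monomial β (c 0 + b) := by
    intro c b
    simp [circuitPoly, hαβ, map_add]
  have hpoly := hmonomial c b
  -- A cancelled polynomial would have empty Newton polytope.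
  have hne : c 0 + b ≠ 0 := by
    intro h0
    have := hf.circuit.newton
    rw [hpoly, h0] at this
    simp [newtonPolytope, Set.range_unique] at this
  have hpos : 0 < c 0 + b := by
    refine lt_of_le_of_ne ?_ hne.symm
    have := hf.nonneg (fun _ => 1)
    rw [hpoly, eval_monomial_eq] at this
    simpa [mon] using this
  have hdeg : β.degree = 2 * d := by
    rw [← hf.degree, hpoly, totalDegree_monomial _ hne]
    rfl
  have hA : exps α β = {β} := by
    ext m; simp [exps, hαβ]
  have hnot := hf.boundary.2
  apply hnot
  rw [mem_interior]
  refine ⟨{c' | 0 < c' (innerExp α β)}, ?_, isOpen_lt continuous_const (continuous_apply _), ?_⟩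
  · intro c' hc'
    have hc' : 0 < c' (innerExp α β) := hc'
    -- Outer and inner exponent coincide here, so splitting the coefficient in half exhibits the
    -- monomial as a circuit polynomial with positive outer coefficient.
    have heq : ofCoeffs (exps α β) c' = circuitPoly α β
        (fun _ => c' (innerExp α β) / 2) (c' (innerExp α β) / 2) := by
      rw [hmonomial, add_halves]
      ext m
      by_cases hm : m ∈ exps α β
      · rw [coeff_ofCoeffs _ _ hm]
        obtain rfl : m = β := by rw [hA] at hm; simpa using hm
        rw [coeff_monomial, if_pos rfl]; rfl
      · rw [coeff_ofCoeffs_of_notMem _ _ hm, coeff_monomial, if_neg]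
        rintro rfl
        exact hm (Finset.mem_insert_self _ _)
    have hmono : ofCoeffs (exps α β) c' = monomial β (c' (innerExp α β)) := by
      rw [heq, hmonomial, add_halves]
    change ofCoeffs (exps α β) c' ∈ sonc n d
    refine mem_sonc ?_ ⟨0, α, β, ⟨h.r_le, ⟨fun _ => c' (innerExp α β) / 2, c' (innerExp α β) / 2,
      fun _ => half_pos hc', heq⟩, h.even, h.simplex, ?_, ⟨w, h.pos, h.sum, h.toPoint_beta⟩⟩⟩ ?_
    · rw [hmono, totalDegree_monomial _ hc'.ne', ← hdeg]
      exact le_rfl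
    · rw [hmono, newtonPolytope, support_monomial, if_neg hc'.ne']
      simp [hαβ, Set.range_unique]
    · intro x
      rw [hmono, eval_monomial_eq]
      exact mul_nonneg hc'.le (mon_nonneg_of_even (by rw [← hαβ 0]; exact h.even 0) x)
  · change 0 < coeff β (circuitPoly α β c b)
    rw [hpoly]
    simpa using hpos

/-- The value of a sign vector under a monomial. -/
def signMon (a : Fin n →₀ ℕ) (s : Fin n → ℤˣ) : ℤˣ := ∏ i, s i ^ a i

lemma mon_sign (a : Fin n →₀ ℕ) (s : Fin n → ℤˣ) :
    mon a (fun i => ((s i : ℤ) : ℝ)) = ((signMon a s : ℤ) : ℝ) := by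
  simp [mon, signMon]

lemma signMon_of_even {a : Fin n →₀ ℕ} (ha : IsEvenExp a) (s : Fin n → ℤˣ) : signMon a s = 1 :=
  Finset.prod_eq_one fun i _ => by
    obtain ⟨k, hk⟩ := ha i
    rw [hk, ← two_mul, pow_mul, Int.units_sq, one_pow]

/-- Flip the sign of one coordinate with odd exponent. -/
lemma exists_signMon_eq_neg_one {a : Fin n →₀ ℕ} (ha : ¬ IsEvenExp a) :
    ∃ s, signMon a s = -1 := by
  simp only [IsEvenExp, not_forall, Nat.not_even_iff_odd] at ha
  obtain ⟨i, hi⟩ := ha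
  refine ⟨Function.update 1 i (-1), ?_⟩
  rw [signMon, Finset.prod_eq_single i]
  · simp [hi.neg_one_pow]
  · intro k _ hk
    simp [hk]
  · simp

/-- Up to a positive factor and a rescaling of the variables by `p`, the polynomial `f` is
`∑ w_j x^{α(j)} - ε x^β`. -/
structure IsNormalForm (f : MvPolynomial (Fin n) ℝ) (α : Fin (r + 1) → Fin n →₀ ℕ)
    (β : Fin n →₀ ℕ) (w c : Fin (r + 1) → ℝ) (b : ℝ) (p : Fin n → ℝ) (K : ℝ) (ε : ℤˣ) : Prop
    extends IsSimplexPoint α β w where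
  r_pos : 0 < r
  c_pos : ∀ j, 0 < c j
  eq : f = circuitPoly α β c b
  p_pos : ∀ i, 0 < p i
  K_pos : 0 < K
  outer : ∀ j, c j * mon (α j) p = w j * K
  inner : b * mon β p = -(((ε : ℤ) : ℝ) * K)
  sign : IsEvenExp β → ε = 1

/-- After substituting x = p y, AM-GM scaled by K dominates the inner term. Inequalities instead of
equalities keep the criterion valid on a neighbourhood of the coefficients. -/
lemma IsSimplexPoint.isNonneg_of_le (h : IsSimplexPoint α β w) {c : Fin (r + 1) → ℝ} {b : ℝ}
    {p : Fin n → ℝ} {K : ℝ} (hp : ∀ i, 0 < p i) (hc : ∀ j, w j * K ≤ c j * mon (α j) p)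
    (hK : 0 ≤ K)
    (hb : -K ≤ b * mon β p) (hb' : ¬ IsEvenExp β → b * mon β p ≤ K) :
    IsNonneg (circuitPoly α β c b) := by
  intro x
  obtain ⟨y, rfl⟩ : ∃ y : Fin n → ℝ, x = fun i => p i * y i :=
    ⟨fun i => x i / p i, by funext i; have := hp i; field_simp⟩
  rw [eval_circuitPoly]
  simp only [mon_mul, ← mul_assoc]
  have h1 : K * ∑ j, w j * mon (α j) y ≤ ∑ j, c j * mon (α j) p * mon (α j) y := by
    rw [Finset.mul_sum]
    refine Finset.sum_le_sum fun j _ => ?_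
    rw [← mul_assoc, mul_comm K]
    exact mul_le_mul_of_nonneg_right (hc j) (mon_nonneg_of_even (h.even j) y)
  have h2 := mul_le_mul_of_nonneg_left (h.abs_mon_beta_le y) hK
  have h3 : -(K * |mon β y|) ≤ b * mon β p * mon β y := by
    by_cases hβ : IsEvenExp β
    · have h0 := mon_nonneg_of_even hβ y
      rw [abs_of_nonneg h0]
      nlinarith
    · have h4 : |b * mon β p * mon β y| ≤ K * |mon β y| := by
        rw [abs_mul]
        exact mul_le_mul_of_nonneg_right (abs_le.2 ⟨hb, hb' hβ⟩) (abs_nonneg _)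
      exact (abs_le.1 h4).1
  linarith

/-- Nonnegativity at the points p·s, s a sign vector, bounds the inner coefficient; being on the
boundary makes a bound tight. -/
theorem IsBoundaryCircuit.exists_normalForm {f : MvPolynomial (Fin n) ℝ}
    (hf : IsBoundaryCircuit d f r α β) :
    ∃ w c b p K ε, IsNormalForm f α β w c b p K ε := by
  have hr := hf.r_pos
  obtain ⟨w, c, b, h, hc, rfl⟩ := hf.circuit.exists_simplexPoint
  obtain ⟨p, K, hp, hK, hout⟩ := h.exists_equalizer hc
  -- At p·s the outer terms are w_j K and add up to K.
  have hsign : ∀ s : Fin n → ℤˣ, 0 ≤ K + b * mon β p * ((signMon β s : ℤ) : ℝ) := by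
    intro s
    have := hf.nonneg (fun i => p i * ((s i : ℤ) : ℝ))
    rw [eval_circuitPoly] at this
    simp only [mon_mul, mon_sign, ← mul_assoc, hout, signMon_of_even (h.even _)] at this
    simpa [← Finset.sum_mul, h.sum] using this
  have hlow : -K ≤ b * mon β p := by
    have := hsign 1
    simp [signMon] at this
    linarith
  have hdeg : ∀ j, (α j).degree ≤ 2 * d := by
    intro j
    rw [← hf.degree]
    apply degree_le_totalDegree
    rw [mem_support_iff, h.coeff_alpha hr]
    exact (hc j).ne'
  suffices hε : b * mon β p = -K ∨ ¬ IsEvenExp β ∧ b * mon β p = K by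
    rcases hε with hε | ⟨hodd, hε⟩
    · exact ⟨w, c, b, p, K, 1, h, hr, hc, rfl, hp, hK, hout, by simpa using hε, fun _ => rfl⟩
    · exact ⟨w, c, b, p, K, -1, h, hr, hc, rfl, hp, hK, hout, by simpa using hε,
        fun he => absurd he hodd⟩
  by_contra! hcon
  have hlow' : -K < b * mon β p := lt_of_le_of_ne hlow hcon.1.symm
  have hupp : ¬ IsEvenExp β → b * mon β p < K := by
    intro hodd
    refine lt_of_le_of_ne ?_ (hcon.2 hodd)
    obtain ⟨s, hs⟩ := exists_signMon_eq_neg_one hodd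
    have := hsign s
    rw [hs] at this
    push_cast at this
    linarith
  -- Shrinking K to K' makes the outer inequalities strict too, so that the criterion becomes an
  -- open condition on the coefficients.
  obtain ⟨K', hK', hK'K, hlow'', hupp'⟩ : ∃ K', 0 < K' ∧ K' < K ∧ -K' < b * mon β p ∧
      (¬ IsEvenExp β → b * mon β p < K') := by
    by_cases hβ : IsEvenExp β
    · obtain ⟨K', h1, h2⟩ := exists_between (max_lt hK (show -(b * mon β p) < K by linarith))
      exact ⟨K', (le_max_left _ _).trans_lt h1, h2, by linarith [(le_max_right _ _).trans_lt h1],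
        fun h' => absurd hβ h'⟩
    · obtain ⟨K', h1, h2⟩ := exists_between
        (max_lt hK (abs_lt.2 ⟨hlow', hupp hβ⟩))
      have h3 := abs_lt.1 ((le_max_right _ _).trans_lt h1)
      exact ⟨K', (le_max_left _ _).trans_lt h1, h2, h3.1, fun _ => h3.2⟩
  apply hf.boundary.2
  rw [mem_interior]
  refine ⟨{c' | (∀ j, w j * K' < c' (outerExp α β j) * mon (α j) p) ∧
    -K' < c' (innerExp α β) * mon β p ∧ (¬ IsEvenExp β → c' (innerExp α β) * mon β p < K')},
    ?_, ?_, ?_⟩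
  · rintro c' ⟨h1, h2, h3⟩
    change ofCoeffs (exps α β) c' ∈ sonc n d
    rw [h.ofCoeffs_eq hr]
    have hc' : ∀ j, 0 < c' (outerExp α β j) := fun j =>
      pos_of_mul_pos_left ((mul_pos (h.pos j) hK').trans (h1 j)) (mon_pos _ hp).le
    exact mem_sonc (h.totalDegree_le hdeg _ _) ⟨r, α, β, h.isCircuit hr hc' _⟩
      (h.isNonneg_of_le hp (fun j => (h1 j).le) hK'.le h2.le fun hβ => (h3 hβ).le)
  · simp only [Set.ofPred_and, Set.ofPred_forall]
    refine (isOpen_iInter_of_finite fun j => ?_).inter (IsOpen.inter ?_ ?_)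
    · exact isOpen_lt continuous_const ((continuous_apply _).mul continuous_const)
    · exact isOpen_lt continuous_const ((continuous_apply _).mul continuous_const)
    · exact isOpen_iInter_of_finite fun _ =>
        isOpen_lt ((continuous_apply _).mul continuous_const) continuous_const
  · refine ⟨fun j => ?_, ?_, fun hβ => ?_⟩
    · change _ < coeff (α j) (circuitPoly α β c b) * _
      rw [h.coeff_alpha hr, hout]
      exact mul_lt_mul_of_pos_left hK'K (h.pos j)
    · change _ < coeff β (circuitPoly α β c b) * _
      rw [h.coeff_beta hr]
      exact hlow''
    · change coeff β (circuitPoly α β c b) * _ < _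
      rw [h.coeff_beta hr]
      exact hupp' hβ

/-- The polynomial `∑ w_j x^{α(j)} - x^β` is a boundary nonnegative circuit polynomial. -/
theorem IsSimplexPoint.isBoundaryCircuit (h : IsSimplexPoint α β w) (hr : 0 < r)
    (hd : ∀ j, (α j).degree ≤ 2 * d) (k : Fin (r + 1)) (hk : (α k).degree = 2 * d) :
    IsBoundaryCircuit d (circuitPoly α β w (-1)) r α β := by
  have hc := h.isCircuit hr h.pos (-1)
  have hmon : ∀ a : Fin n →₀ ℕ, mon a 1 = 1 := fun a => by simp [mon]
  have hnn : IsNonneg (circuitPoly α β w (-1)) :=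
    h.isNonneg_of_le (p := 1) (K := 1) (fun _ => one_pos) (fun j => by simp [hmon]) zero_le_one
      (by simp [hmon]) (fun _ => by simp [hmon])
  have hdeg := h.totalDegree_le hd w (-1)
  refine ⟨hc, hnn, le_antisymm hdeg ?_, ?_⟩
  · rw [← hk]
    apply degree_le_totalDegree
    rw [mem_support_iff, h.coeff_alpha hr]
    exact (h.pos k).ne'
  · change _ ∈ frontier {c : exps α β → ℝ | ofCoeffs (exps α β) c ∈ sonc n d}
    refine ⟨subset_closure ?_, fun hint => ?_⟩
    · change ofCoeffs (exps α β) _ ∈ sonc n d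
      rw [h.ofCoeffs_eq hr]
      have h1 : (fun j => coeff (outerExp α β j : Fin n →₀ ℕ) (circuitPoly α β w (-1))) = w := by
        funext j; exact h.coeff_alpha hr _ _ j
      have h2 : coeff (innerExp α β : Fin n →₀ ℕ) (circuitPoly α β w (-1)) = -1 :=
        h.coeff_beta hr _ _
      rw [h1, h2]
      exact mem_sonc hdeg ⟨r, α, β, hc⟩ hnn
    · set v : exps α β → ℝ := fun a => coeff (a : Fin n →₀ ℕ) (circuitPoly α β w (-1)) with hv
      -- Lowering the inner coefficient to -1 - t gives the value -t at (1, …, 1), so arbitrarily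
      -- small t > 0 leave the cone.
      have hcont : Continuous fun t : ℝ => Function.update v (innerExp α β) (-1 - t) :=
        continuous_const.update _ (by fun_prop)
      have h0 : Function.update v (innerExp α β) (-1 - (0 : ℝ)) = v := by
        rw [Function.update_eq_self_iff, hv]
        simp only [sub_zero]
        exact (h.coeff_beta hr _ _).symm
      have hmem : ∀ᶠ t in nhds (0 : ℝ), Function.update v (innerExp α β) (-1 - t) ∈
          {c : exps α β → ℝ | ofCoeffs (exps α β) c ∈ sonc n d} := by
        apply hcont.continuousAt.eventually
        beta_reduce
        rw [h0]
        exact mem_interior_iff_mem_nhds.1 hint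
      obtain ⟨t, ht, hpos⟩ := ((hmem.filter_mono nhdsWithin_le_nhds).and
        (self_mem_nhdsWithin : Set.Ioi (0 : ℝ) ∈ nhdsWithin 0 (Set.Ioi 0))).exists
      have := isNonneg_of_mem_sonc ht 1
      rw [h.ofCoeffs_eq hr, eval_circuitPoly] at this
      have h3 : ∀ j, Function.update v (innerExp α β) (-1 - t) (outerExp α β j) = w j := by
        intro j
        rw [Function.update_of_ne]
        · exact h.coeff_alpha hr _ _ j
        · intro he
          exact h.beta_ne hr j (congrArg Subtype.val he)
      simp only [h3, hmon, mul_one, h.sum, Function.update_self] at this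
      have : 0 < t := hpos
      linarith

end

section

variable {n r d : ℕ} {α : Fin (r + 1) → Fin n →₀ ℕ} {β : Fin n →₀ ℕ} {w c : Fin (r + 1) → ℝ}
  {b K : ℝ} {p : Fin n → ℝ} {ε : ℤˣ} {f : MvPolynomial (Fin n) ℝ}

/-! ### Affine zeros -/

/-- The real zeros all of whose coordinates are nonzero. -/
def torusZeros (f : MvPolynomial (Fin n) ℝ) : Set (Fin n → ℝ) :=
  {x | x ∈ affineZeros f ∧ ∀ i, x i ≠ 0}

/-- Some outer exponent lies on the `i`-th coordinate axis. -/
def HasAxisExp (α : Fin (r + 1) → Fin n →₀ ℕ) (i : Fin n) : Prop :=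
  ∃ j, ∀ k, k ≠ i → α j k = 0

namespace IsNormalForm

lemma eval_scaled (h : IsNormalForm f α β w c b p K ε) (y : Fin n → ℝ) :
    eval (fun i => p i * y i) f = K * (∑ j, w j * mon (α j) y - ((ε : ℤ) : ℝ) * mon β y) := by
  rw [h.eq, eval_circuitPoly]
  simp only [mon_mul, ← mul_assoc, h.outer, h.inner]
  rw [mul_sub, Finset.mul_sum]
  rw [Finset.sum_congr rfl fun j _ => show w j * K * mon (α j) y = K * (w j * mon (α j) y) by ring]
  ring

/-- A zero forces equality throughout ε y^β ≤ |y^β| ≤ ∑ w_j y^{α(j)}; the second equality is the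
equality case of AM-GM. -/
lemma mem_affineZeros_scaled_iff (h : IsNormalForm f α β w c b p K ε) (y : Fin n → ℝ) :
    (fun i => p i * y i) ∈ affineZeros f ↔
      (∀ j k, mon (α j) y = mon (α k) y) ∧ ((ε : ℤ) : ℝ) * mon β y = |mon β y| := by
  have hle : ((ε : ℤ) : ℝ) * mon β y ≤ |mon β y| := by
    rcases Int.units_eq_one_or ε with rfl | rfl
    · simpa using le_abs_self _
    · simpa using neg_le_abs _
  have hle' := h.abs_mon_beta_le y
  change eval _ f = 0 ↔ _
  rw [h.eval_scaled, mul_eq_zero, or_iff_right h.K_pos.ne', ← h.abs_mon_beta_eq_iff]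
  constructor
  · intro h0
    constructor <;> linarith
  · rintro ⟨h1, h2⟩
    linarith

lemma exists_sign (h : IsNormalForm f α β w c b p K ε) : ∃ s, signMon β s = ε := by
  rcases Int.units_eq_one_or ε with rfl | rfl
  · exact ⟨1, by simp [signMon]⟩
  · exact exists_signMon_eq_neg_one fun he => by simpa using h.sign he

/-- Along the curve p·s·exp(t l), with l constant on the simplex and s^β = ε, all outer monomials
stay equal. -/
lemma infinite_of_lt (h : IsNormalForm f α β w c b p K ε) (hr : r < n) :
    (affineZeros f).Infinite := by
  obtain ⟨l, u, hl, hu⟩ := exists_constant_ne_zero hr α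
  obtain ⟨s, hs⟩ := h.exists_sign
  obtain ⟨i, hi⟩ := Function.ne_iff.1 hl
  refine Set.infinite_of_injective_forall_mem
    (f := fun t : ℝ => fun i => p i * (((s i : ℤ) : ℝ) * Real.exp (t * l i))) ?_ fun t => ?_
  · intro t t' htt
    have := congrFun htt i
    simp only [mul_eq_mul_left_iff, (h.p_pos i).ne', or_false, Real.exp_eq_exp,
      mul_eq_mul_right_iff] at this
    rcases this with (this | this) | this
    · exact this
    · exact absurd this hi
    · simp at this
  · rw [h.mem_affineZeros_scaled_iff]
    have hmon : ∀ a : Fin n →₀ ℕ, mon a (fun i => ((s i : ℤ) : ℝ) * Real.exp (t * l i)) =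
        ((signMon a s : ℤ) : ℝ) * Real.exp (t * ∑ i, (a i : ℝ) * l i) := by
      intro a
      rw [mon_mul, mon_sign, mon_exp, Finset.mul_sum]
      congr 2
      exact Finset.sum_congr rfl fun i _ => by ring
    constructor
    · intro j k
      rw [hmon, hmon, signMon_of_even (h.even j), signMon_of_even (h.even k), hu, hu]
    · rw [hmon, hs, abs_mul, abs_of_pos (Real.exp_pos _), ← mul_assoc]
      rcases Int.units_eq_one_or ε with rfl | rfl <;> simp

lemma isFullDim_iff (h : IsNormalForm f α β w c b p K ε) : IsFullDim f ↔ r = n := by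
  rw [IsFullDim, h.eq, h.newton_eq h.r_pos h.c_pos, affineSpan_convexHull,
    h.simplex.affineSpan_eq_top_iff_card_eq_finrank_add_one]
  simp

lemma hasConstantTerm_iff (h : IsNormalForm f α β w c b p K ε) :
    HasConstantTerm f ↔ ∃ j, α j = 0 := by
  constructor
  · intro hf
    rw [HasConstantTerm, ← mem_support_iff, h.eq] at hf
    rcases IsSimplexPoint.support_subset c b hf with h0 | ⟨j, hj⟩
    -- If β = 0, positivity of the weights makes every outer exponent 0 as well.
    · refine absurd ?_ (h.beta_ne h.r_pos 0)
      rw [← h0]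
      ext i
      exact h.alpha_eq_zero (by simp [← h0]) 0
    · exact ⟨j, hj.symm⟩
  · rintro ⟨j, hj⟩
    rw [HasConstantTerm, h.eq, ← hj, h.coeff_alpha h.r_pos]
    exact (h.c_pos j).ne'

end IsNormalForm

/-! ### Full-dimensional simplices: zeros in the torus and on the coordinate hyperplanes -/

namespace IsNormalForm

variable {α : Fin (n + 1) → Fin n →₀ ℕ} {w c : Fin (n + 1) → ℝ}

/-- Otherwise the whole simplex would lie in a coordinate hyperplane. -/
lemma beta_ne_zero (h : IsNormalForm f α β w c b p K ε) (i : Fin n) : β i ≠ 0 := by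
  intro hi
  have := eq_zero_of_constant h.simplex (l := Pi.single i 1) (h := 0) fun j => by
    simp [Pi.single_apply, h.alpha_eq_zero hi j]
  simpa using congrFun this i

lemma torusZeros_eq (h : IsNormalForm f α β w c b p K ε) :
    torusZeros f = (fun (s : Fin n → ℤˣ) i => p i * ((s i : ℤ) : ℝ)) '' {s | signMon β s = ε} := by
  ext x
  constructor
  · rintro ⟨hx, hx0⟩
    obtain ⟨y, rfl⟩ : ∃ y : Fin n → ℝ, x = fun i => p i * y i :=
      ⟨fun i => x i / p i, by funext i; have := h.p_pos i; field_simp⟩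
    have hy0 : ∀ i, y i ≠ 0 := fun i => right_ne_zero_of_mul (hx0 i)
    rw [h.mem_affineZeros_scaled_iff] at hx
    obtain ⟨h1, h2⟩ := hx
    -- Equal outer monomials mean that the linear form log|y| is constant on the vertices of a
    -- full-dimensional simplex.
    have hl : (fun i => Real.log |y i|) = 0 := by
      apply eq_zero_of_constant h.simplex (h := Real.log (mon (α 0) y))
      intro j
      rw [← h1 j 0, ← h.abs_mon_alpha j y, ← mon_abs, mon,
        Real.log_prod fun i _ => pow_ne_zero _ (abs_pos.2 (hy0 i)).ne']
      simp
    have hy : ∀ i, y i = 1 ∨ y i = -1 := by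
      intro i
      have := congrFun hl i
      have h3 : |y i| = 1 := Real.eq_one_of_pos_of_log_eq_zero (abs_pos.2 (hy0 i)) this
      exact (abs_eq zero_le_one).1 h3
    obtain ⟨s, rfl⟩ : ∃ s : Fin n → ℤˣ, y = fun i => ((s i : ℤ) : ℝ) := by
      have : ∀ i, ∃ s : ℤˣ, y i = ((s : ℤ) : ℝ) := fun i =>
        (hy i).elim (fun h => ⟨1, by simp [h]⟩) (fun h => ⟨-1, by simp [h]⟩)
      choose s hs using this
      exact ⟨s, funext hs⟩
    refine ⟨s, ?_, rfl⟩
    rw [mon_sign] at h2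
    change signMon β s = ε
    rcases Int.units_eq_one_or ε with rfl | rfl <;>
      rcases Int.units_eq_one_or (signMon β s) with h3 | h3 <;> simp [h3] at h2 ⊢ <;>
      norm_num at h2
  · rintro ⟨s, hs, rfl⟩
    refine ⟨?_, fun i => mul_ne_zero (h.p_pos i).ne' (by simp)⟩
    rw [h.mem_affineZeros_scaled_iff]
    have hs : signMon β s = ε := hs
    simp only [mon_sign, signMon_of_even (h.even _), hs]
    refine ⟨fun _ _ => trivial, ?_⟩
    rcases Int.units_eq_one_or ε with rfl | rfl <;> simp

lemma encard_torusZeros (h : IsNormalForm f α β w c b p K ε) :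
    (torusZeros f).encard = {s | signMon β s = ε}.encard := by
  rw [h.torusZeros_eq]
  apply Function.Injective.encard_image
  intro s t hst
  funext i
  have := congrFun hst i
  simpa [(h.p_pos i).ne', Units.ext_iff] using this

lemma finite_torusZeros (h : IsNormalForm f α β w c b p K ε) : (torusZeros f).Finite := by
  rw [h.torusZeros_eq]
  exact (Set.toFinite _).image _

/-- The inner monomial involves every variable and vanishes, leaving a sum of nonnegative terms. -/
lemma mem_affineZeros_of_coord_eq_zero (h : IsNormalForm f α β w c b p K ε) {x : Fin n → ℝ}
    {i : Fin n} (hi : x i = 0) : x ∈ affineZeros f ↔ ∀ j, mon (α j) x = 0 := by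
  have hβ : mon β x = 0 := (mon_eq_zero_iff _ _).2 ⟨i, hi, h.beta_ne_zero i⟩
  change eval x f = 0 ↔ _
  rw [h.eq, eval_circuitPoly, hβ, mul_zero, add_zero, Finset.sum_eq_zero_iff_of_nonneg
    fun j _ => mul_nonneg (h.c_pos j).le (mon_nonneg_of_even (h.even j) x)]
  simp [fun j => (h.c_pos j).ne']

lemma affineZeros_of_constant (h : IsNormalForm f α β w c b p K ε) (hf : HasConstantTerm f) :
    affineZeros f = torusZeros f := by
  refine Set.Subset.antisymm (fun x hx => ⟨hx, fun i hi => ?_⟩) fun x hx => hx.1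
  obtain ⟨j, hj⟩ := h.hasConstantTerm_iff.1 hf
  have := (h.mem_affineZeros_of_coord_eq_zero hi).1 hx j
  simp [hj, mon] at this

lemma affineZeros_of_axes (h : IsNormalForm f α β w c b p K ε) (hn : 0 < n)
    (hf : ¬ HasConstantTerm f) (hax : ∀ i, HasAxisExp α i) :
    affineZeros f = insert 0 (torusZeros f) := by
  ext x
  constructor
  · intro hx
    by_cases h0 : ∀ i, x i ≠ 0
    · exact Or.inr ⟨hx, h0⟩
    · left
      push Not at h0
      obtain ⟨i, hi⟩ := h0
      rw [h.mem_affineZeros_of_coord_eq_zero hi] at hx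
      funext k
      obtain ⟨j, hj⟩ := hax k
      obtain ⟨m, hm, hm'⟩ := (mon_eq_zero_iff _ _).1 (hx j)
      by_cases hmk : m = k
      · rw [← hmk]; exact hm
      · exact absurd (hj m hmk) hm'
  · rintro (rfl | hx)
    · rw [h.mem_affineZeros_of_coord_eq_zero (i := ⟨0, hn⟩) rfl]
      intro j
      rw [mon_eq_zero_iff]
      by_contra! hcon
      exact hf (h.hasConstantTerm_iff.2 ⟨j, by ext i; exact hcon i rfl⟩)
    · exact hx.1

/-- Every outer monomial contains a variable other than x_i, so the whole i-th axis consists of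
zeros. -/
lemma infinite_of_missing_axis (h : IsNormalForm f α β w c b p K ε) (hn : 2 ≤ n) {i : Fin n}
    (hi : ¬ HasAxisExp α i) : (affineZeros f).Infinite := by
  refine Set.infinite_of_injective_forall_mem
    (f := fun t : ℝ => (Pi.single i t : Fin n → ℝ)) (fun s t hst => by
      simpa using congrFun hst i) fun t => ?_
  have : Nontrivial (Fin n) := Fin.nontrivial_iff_two_le.2 hn
  obtain ⟨k, hk⟩ := exists_ne i
  rw [h.mem_affineZeros_of_coord_eq_zero (i := k) (by simp [hk])]
  intro j
  rw [mon_eq_zero_iff]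
  simp only [HasAxisExp, not_exists, not_forall] at hi
  obtain ⟨m, hm, hm'⟩ := hi j
  exact ⟨m, by simp [hm], hm'⟩

/-- The exponent 0 satisfies `HasAxisExp` for every axis, so one criterion covers both cases. -/
lemma finite_affineZeros (h : IsNormalForm f α β w c b p K ε) (hn : 0 < n)
    (hax : ∀ i, HasAxisExp α i) : (affineZeros f).Finite := by
  by_cases hf : HasConstantTerm f
  · rw [h.affineZeros_of_constant hf]
    exact h.finite_torusZeros
  · rw [h.affineZeros_of_axes hn hf hax]
    exact h.finite_torusZeros.insert 0

lemma encard_affineZeros_of_axes (h : IsNormalForm f α β w c b p K ε) (hn : 0 < n)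
    (hf : ¬ HasConstantTerm f) (hax : ∀ i, HasAxisExp α i) :
    (affineZeros f).encard = (torusZeros f).encard + 1 := by
  rw [h.affineZeros_of_axes hn hf hax, Set.encard_insert_of_notMem]
  rintro ⟨-, h0⟩
  exact h0 ⟨0, hn⟩ rfl

lemma exists_degree_lt (h : IsNormalForm f α β w c b p K ε) (hn : 0 < n) {D : ℕ}
    (hD : ∀ j, (α j).degree ≤ D) : ∃ j, (α j).degree < D := by
  by_contra! hcon
  have := eq_zero_of_constant h.simplex (l := 1) (h := D) fun j => by
    simp only [Pi.one_apply, mul_one, ← Nat.cast_sum, ← Finsupp.degree_eq_sum]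
    exact_mod_cast le_antisymm (hD j) (hcon j)
  simpa using congrFun this ⟨0, hn⟩

end IsNormalForm

lemma encard_signs_even {β : Fin 2 →₀ ℕ} (hβ : IsEvenExp β) :
    {s : Fin 2 → ℤˣ | signMon β s = 1}.encard = 4 := by
  simp only [signMon_of_even hβ]
  rw [Set.ofPred_true, Set.encard_univ, ENat.card_eq_coe_fintype_card]
  rfl

lemma units_pow_mod_two (u : ℤˣ) (m : ℕ) : u ^ m = u ^ (m % 2) := by
  conv_lhs => rw [← Nat.div_add_mod m 2, pow_add, pow_mul, Int.units_sq, one_pow, one_mul]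

/-- Only the parities of β matter, which reduces the count to a finite check. -/
lemma encard_signs_odd {β : Fin 2 →₀ ℕ} (hβ : ¬ IsEvenExp β) (ε : ℤˣ) :
    {s : Fin 2 → ℤˣ | signMon β s = ε}.encard = 2 := by
  have hs : {s : Fin 2 → ℤˣ | signMon β s = ε} =
      ((Finset.univ.filter fun s : Fin 2 → ℤˣ =>
        s 0 ^ (β 0 % 2) * s 1 ^ (β 1 % 2) = ε : Finset _) : Set (Fin 2 → ℤˣ)) := by
    ext s
    simp [signMon, Fin.prod_univ_two, ← units_pow_mod_two]
  rw [hs, Set.encard_coe_eq_coe_finsetCard]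
  have hodd : ¬ (β 0 % 2 = 0 ∧ β 1 % 2 = 0) := by
    simpa [IsEvenExp, Fin.forall_fin_two, Nat.even_iff] using hβ
  have h2 : ∀ (ε : ℤˣ) (a b : Fin 2), ¬ (a = 0 ∧ b = 0) →
      (Finset.univ.filter fun s : Fin 2 → ℤˣ =>
        s 0 ^ (a : ℕ) * s 1 ^ (b : ℕ) = ε).card = 2 := by decide
  have := h2 ε ⟨β 0 % 2, Nat.mod_lt _ two_pos⟩ ⟨β 1 % 2, Nat.mod_lt _ two_pos⟩
    (by simpa [Fin.ext_iff] using hodd)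
  simp only at this
  rw [this]
  rfl

end

section

variable {n r d : ℕ} {α : Fin (r + 1) → Fin n →₀ ℕ} {β : Fin n →₀ ℕ} {w c : Fin (r + 1) → ℝ}
  {b K : ℝ} {p : Fin n → ℝ} {ε : ℤˣ} {f : MvPolynomial (Fin n) ℝ}

/-! ### Projective zeros -/

lemma eval_homogenization (d : ℕ) (f : MvPolynomial (Fin n) ℝ) (t : ℝ) (x : Fin n → ℝ) :
    eval (Fin.cons t x) (homogenization d f) =
      ∑ a ∈ f.support, coeff a f * (t ^ (2 * d - a.degree) * mon a x) := by
  simp [homogenization, eval_monomial_eq, mon, Fin.prod_univ_succ]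

lemma eval_eq_sum_mon (f : MvPolynomial (Fin n) ℝ) (x : Fin n → ℝ) :
    eval x f = ∑ a ∈ f.support, coeff a f * mon a x := by
  rw [eval_eq']
  rfl

lemma eval_homogenization_smul (hf : f.totalDegree ≤ 2 * d) (s : ℝ) (v : Fin (n + 1) → ℝ) :
    eval (s • v) (homogenization d f) = s ^ (2 * d) * eval v (homogenization d f) := by
  have hv : s • v = Fin.cons (s * v 0) (s • Fin.tail v) := by
    funext i
    refine Fin.cases ?_ (fun i => ?_) i <;> simp [Fin.tail]
  rw [hv, eval_homogenization]
  conv_rhs => rw [← Fin.cons_self_tail v, eval_homogenization]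
  rw [Finset.mul_sum]
  refine Finset.sum_congr rfl fun a ha => ?_
  have hle : a.degree ≤ 2 * d := (degree_le_totalDegree ha).trans hf
  rw [mon_smul, mul_pow]
  conv_rhs => rw [← Nat.sub_add_cancel hle, pow_add]
  rw [Nat.add_sub_cancel]
  ring

lemma eval_homogenization_cons_one (d : ℕ) (f : MvPolynomial (Fin n) ℝ) (x : Fin n → ℝ) :
    eval (Fin.cons 1 x) (homogenization d f) = eval x f := by
  rw [eval_homogenization, eval_eq_sum_mon]
  simp

/-- Homogeneity makes vanishing independent of the representative chosen by `rep`. -/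
lemma mk_mem_projZeros_iff (hf : f.totalDegree ≤ 2 * d) {v : Fin (n + 1) → ℝ} (hv : v ≠ 0) :
    Projectivization.mk ℝ v hv ∈ projZeros (homogenization d f) ↔
      eval v (homogenization d f) = 0 := by
  obtain ⟨a, ha⟩ := Projectivization.exists_smul_eq_mk_rep ℝ v hv
  change eval (Projectivization.mk ℝ v hv).rep _ = 0 ↔ _
  rw [← ha, Units.smul_def, eval_homogenization_smul hf, mul_eq_zero,
    or_iff_right (pow_ne_zero _ a.ne_zero)]

lemma mk_mem_zerosAtInfinity_iff (hf : f.totalDegree ≤ 2 * d) {v : Fin (n + 1) → ℝ}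
    (hv : v ≠ 0) :
    Projectivization.mk ℝ v hv ∈ zerosAtInfinity (homogenization d f) ↔
      eval v (homogenization d f) = 0 ∧ v 0 = 0 := by
  obtain ⟨a, ha⟩ := Projectivization.exists_smul_eq_mk_rep ℝ v hv
  change _ ∈ projZeros _ ∧ (Projectivization.mk ℝ v hv).rep 0 = 0 ↔ _
  rw [mk_mem_projZeros_iff hf, ← ha]
  simp [Units.smul_def]

lemma cons_one_ne_zero (x : Fin n → ℝ) : (Fin.cons 1 x : Fin (n + 1) → ℝ) ≠ 0 := by
  intro h
  simpa using congrFun h 0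

/-- The embedding of affine space into projective space. -/
def affineChart (x : Fin n → ℝ) : Projectivization ℝ (Fin (n + 1) → ℝ) :=
  Projectivization.mk ℝ (Fin.cons 1 x) (cons_one_ne_zero x)

lemma affineChart_injective : Function.Injective (affineChart (n := n)) := by
  intro x y h
  obtain ⟨a, ha⟩ := (Projectivization.mk_eq_mk_iff' ℝ _ _ _ _).1 h
  have h0 := congrFun ha 0
  simp only [Pi.smul_apply, Fin.cons_zero, smul_eq_mul, mul_one] at h0
  funext i
  have := congrFun ha i.succ
  simpa [h0] using this.symm

lemma projZeros_eq (hf : f.totalDegree ≤ 2 * d) :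
    projZeros (homogenization d f) =
      affineChart '' affineZeros f ∪ zerosAtInfinity (homogenization d f) := by
  ext P
  induction P using Projectivization.ind with
  | h v hv =>
  rw [Set.mem_union, mk_mem_zerosAtInfinity_iff hf, mk_mem_projZeros_iff hf]
  constructor
  · intro h
    by_cases h0 : v 0 = 0
    · exact Or.inr ⟨h, h0⟩
    · left
      have hv' : v = v 0 • (Fin.cons 1 (fun i => v i.succ / v 0) : Fin (n + 1) → ℝ) := by
        funext i
        refine Fin.cases ?_ (fun i => ?_) i
        · simp
        · simp only [Pi.smul_apply, Fin.cons_succ, smul_eq_mul]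
          field_simp
      refine ⟨fun i => v i.succ / v 0, ?_, ?_⟩
      · rw [hv', eval_homogenization_smul hf, mul_eq_zero, or_iff_right (pow_ne_zero _ h0),
          eval_homogenization_cons_one] at h
        exact h
      · exact (Projectivization.mk_eq_mk_iff' ℝ _ _ _ _).2 ⟨(v 0)⁻¹,
          (inv_smul_eq_iff₀ h0).2 hv'⟩
  · rintro (⟨x, hx, hxv⟩ | h)
    · rw [← mk_mem_projZeros_iff hf hv, ← hxv, affineChart, mk_mem_projZeros_iff hf,
        eval_homogenization_cons_one]
      exact hx
    · exact h.1

theorem encard_projZeros (hf : f.totalDegree ≤ 2 * d) :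
    (projZeros (homogenization d f)).encard =
      (affineZeros f).encard + (zerosAtInfinity (homogenization d f)).encard := by
  rw [projZeros_eq hf, Set.encard_union_eq, affineChart_injective.encard_image]
  rw [Set.disjoint_left]
  rintro _ ⟨x, -, rfl⟩ h
  have := ((mk_mem_zerosAtInfinity_iff hf (cons_one_ne_zero x)).1 h).2
  simp at this

/-! ### Zeros at infinity -/

/-- Some outer exponent of degree `D` is supported in `s`. -/
def HasTopExp (α : Fin (r + 1) → Fin n →₀ ℕ) (D : ℕ) (s : Set (Fin n)) : Prop :=
  ∃ j, (α j).degree = D ∧ ∀ m, m ∉ s → α j m = 0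

namespace IsNormalForm

lemma alpha_mem_support (h : IsNormalForm f α β w c b p K ε) (j : Fin (r + 1)) :
    α j ∈ f.support := by
  rw [mem_support_iff, h.eq, h.coeff_alpha h.r_pos]
  exact (h.c_pos j).ne'

lemma degree_le (h : IsNormalForm f α β w c b p K ε) (hf : f.totalDegree = 2 * d)
    (j : Fin (r + 1)) : (α j).degree ≤ 2 * d :=
  hf ▸ degree_le_totalDegree (h.alpha_mem_support j)

lemma exists_degree_eq (h : IsNormalForm f α β w c b p K ε) (hf : f.totalDegree = 2 * d) :
    ∃ j, (α j).degree = 2 * d := by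
  by_contra! hcon
  have hlt : ∀ j, (α j).degree < 2 * d := fun j => lt_of_le_of_ne (h.degree_le hf j) (hcon j)
  have := h.totalDegree_le (fun j => Nat.le_sub_one_of_lt (hlt j)) c b
  rw [← h.eq, hf] at this
  have := hlt 0
  omega

/-- One outer exponent of lower degree forces β below 2d, so at x₀ = 0 only the top outer terms
survive, and these are nonnegative. -/
lemma eval_at_infinity_iff (h : IsNormalForm f α β w c b p K ε) (hf : f.totalDegree = 2 * d)
    (hlow : ∃ j, (α j).degree < 2 * d) (x : Fin n → ℝ) :
    eval (Fin.cons 0 x) (homogenization d f) = 0 ↔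
      ∀ j, (α j).degree = 2 * d → mon (α j) x = 0 := by
  obtain ⟨k, hk⟩ := hlow
  have hβ : β.degree < 2 * d := h.degree_beta_lt (h.degree_le hf) k hk
  have hzero : (0 : ℝ) ^ (2 * d - β.degree) = 0 := zero_pow (by omega)
  have hcoeff : ∀ j, coeff (α j) f = c j := fun j => by rw [h.eq, h.coeff_alpha h.r_pos]
  have hmem : ∀ a ∈ f.support, a = β ∨ ∃ j, a = α j := fun a ha =>
    IsSimplexPoint.support_subset c b (h.eq ▸ ha)
  rw [eval_homogenization, Finset.sum_eq_zero_iff_of_nonneg]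
  · constructor
    · intro h0 j hj
      have := h0 (α j) (h.alpha_mem_support j)
      simpa [hcoeff, hj, (h.c_pos j).ne'] using this
    · intro h0 a ha
      rcases hmem a ha with rfl | ⟨j, rfl⟩
      · rw [hzero, zero_mul, mul_zero]
      · by_cases hj : (α j).degree = 2 * d
        · rw [h0 j hj, mul_zero, mul_zero]
        · have := h.degree_le hf j
          rw [zero_pow (by omega), zero_mul, mul_zero]
  · intro a ha
    rcases hmem a ha with rfl | ⟨j, rfl⟩
    · rw [hzero, zero_mul, mul_zero]
    · rw [hcoeff]
      exact mul_nonneg (h.c_pos j).le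
        (mul_nonneg (pow_nonneg le_rfl _) (mon_nonneg_of_even (h.even j) x))

lemma infinite_zerosAtInfinity (h : IsNormalForm f α β w c b p K ε)
    (hf : f.totalDegree = 2 * d) (hlow : ∃ j, (α j).degree < 2 * d) {i k : Fin n} (hik : i ≠ k)
    (htop : ¬ HasTopExp α (2 * d) {i, k}) : (zerosAtInfinity (homogenization d f)).Infinite := by
  -- Points of the projective line joining the i-th and k-th coordinate points.
  let x : ℝ → Fin n → ℝ := fun t => Pi.single i 1 + Pi.single k t
  have hxi : ∀ t, x t i = 1 := fun t => by simp [x, hik]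
  have hxk : ∀ t, x t k = t := fun t => by simp [x, hik.symm]
  have hne : ∀ t, (Fin.cons 0 (x t) : Fin (n + 1) → ℝ) ≠ 0 := fun t h0 => by
    simpa [hxi] using congrFun h0 i.succ
  refine Set.infinite_of_injective_forall_mem
    (f := fun t : ℝ => Projectivization.mk ℝ (Fin.cons 0 (x t)) (hne t)) ?_ fun t => ?_
  · intro s t hst
    obtain ⟨a, ha⟩ := (Projectivization.mk_eq_mk_iff' ℝ _ _ _ _).1 hst
    have h1 := congrFun ha i.succ
    have h2 := congrFun ha k.succ
    simp only [Pi.smul_apply, Fin.cons_succ, hxi, hxk, smul_eq_mul, mul_one] at h1 h2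
    rw [← h2, h1, one_mul]
  · rw [mk_mem_zerosAtInfinity_iff hf.le, h.eval_at_infinity_iff hf hlow]
    refine ⟨fun j hj => ?_, rfl⟩
    rw [mon_eq_zero_iff]
    by_contra! hcon
    refine htop ⟨j, hj, fun m hm => hcon m ?_⟩
    simp only [Set.mem_insert_iff, Set.mem_singleton_iff, not_or] at hm
    simp [x, hm.1, hm.2]

/-- If every pair of coordinates carries an exponent of top degree, then the zeros at infinity
are coordinate points. -/
lemma encard_zerosAtInfinity (h : IsNormalForm f α β w c b p K ε)
    (hf : f.totalDegree = 2 * d) (hlow : ∃ j, (α j).degree < 2 * d)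
    (htop : ∀ i k, i ≠ k → HasTopExp α (2 * d) {i, k}) :
    (zerosAtInfinity (homogenization d f)).encard =
      {i | ¬ HasTopExp α (2 * d) {i}}.encard := by
  have hne : ∀ i : Fin n, (Fin.cons 0 (Pi.single i 1) : Fin (n + 1) → ℝ) ≠ 0 := fun i h0 => by
    simpa using congrFun h0 i.succ
  have hinj : Function.Injective fun i : Fin n =>
      Projectivization.mk ℝ (Fin.cons 0 (Pi.single i 1) : Fin (n + 1) → ℝ) (hne i) := by
    intro i k hik
    obtain ⟨a, ha⟩ := (Projectivization.mk_eq_mk_iff' ℝ _ _ _ _).1 hik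
    by_contra hne
    have := congrFun ha i.succ
    simp [hne] at this
  rw [← hinj.encard_image]
  congr 1
  ext P
  constructor
  · induction P using Projectivization.ind with
    | h v hv =>
    rw [mk_mem_zerosAtInfinity_iff hf.le]
    rintro ⟨h1, h0⟩
    have hv' : v = Fin.cons 0 (Fin.tail v) := by rw [← h0, Fin.cons_self_tail]
    rw [hv', h.eval_at_infinity_iff hf hlow] at h1
    obtain ⟨i, hi⟩ : ∃ i, Fin.tail v i ≠ 0 := by
      by_contra! hcon
      apply hv
      rw [hv']
      funext i
      refine Fin.cases ?_ (fun i => ?_) i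
      · rfl
      · simpa using hcon i
    -- With two nonzero coordinates, the top monomial supported on that pair would not vanish.
    have hother : ∀ k, k ≠ i → Fin.tail v k = 0 := by
      intro k hk
      by_contra hk0
      obtain ⟨j, hj, hsupp⟩ := htop i k hk.symm
      obtain ⟨m, hm, hm'⟩ := (mon_eq_zero_iff _ _).1 (h1 j hj)
      refine hm' (hsupp m ?_)
      rintro (rfl | rfl)
      exacts [hi hm, hk0 hm]
    refine ⟨i, ?_, ?_⟩
    · rintro ⟨j, hj, hsupp⟩
      obtain ⟨m, hm, hm'⟩ := (mon_eq_zero_iff _ _).1 (h1 j hj)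
      refine hm' (hsupp m ?_)
      rintro rfl
      exact hi hm
    · refine (Projectivization.mk_eq_mk_iff' ℝ _ _ _ _).2 ⟨(Fin.tail v i)⁻¹, ?_⟩
      funext m
      refine Fin.cases ?_ (fun m => ?_) m
      · simp [h0]
      · by_cases hm : m = i
        · subst hm
          simpa [Fin.tail] using inv_mul_cancel₀ hi
        · have := hother m hm
          rw [Fin.tail] at this
          simp [hm, this]
  · rintro ⟨i, hi, rfl⟩
    rw [mk_mem_zerosAtInfinity_iff hf.le, h.eval_at_infinity_iff hf hlow]
    refine ⟨fun j hj => ?_, rfl⟩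
    rw [mon_eq_zero_iff]
    by_contra! hcon
    refine hi ⟨j, hj, fun m hm => hcon m ?_⟩
    have : m ≠ i := hm
    simp [this]

end IsNormalForm

end

section

variable {n r d : ℕ} {α : Fin (r + 1) → Fin n →₀ ℕ} {β : Fin n →₀ ℕ} {w c : Fin (r + 1) → ℝ}
  {b K : ℝ} {p : Fin n → ℝ} {ε : ℤˣ} {f : MvPolynomial (Fin n) ℝ}

/-! ### Counting the zeros -/

/-- The prescribed supports, singletons from A and pairs from S, are pairwise distinct, and each
exponent realizes only one. -/
lemma card_add_choose_le {A S : Finset (Fin n)} {J : Finset (Fin (r + 1))}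
    (hA : ∀ i ∈ A, ∃ j ∈ J, (α j).support = {i})
    (hS : ∀ i ∈ S, ∀ k ∈ S, i ≠ k → ∃ j ∈ J, (α j).support = {i, k}) :
    A.card + S.card.choose 2 ≤ J.card := by
  classical
  have hdisj : Disjoint (A.image fun i => ({i} : Finset (Fin n))) (S.powersetCard 2) := by
    rw [Finset.disjoint_left]
    intro T hT hT'
    obtain ⟨i, -, rfl⟩ := Finset.mem_image.1 hT
    simpa using (Finset.mem_powersetCard.1 hT').2
  have hsub : (A.image fun i => ({i} : Finset (Fin n))) ∪ S.powersetCard 2 ⊆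
      J.image fun j => (α j).support := by
    intro T hT
    rw [Finset.mem_image]
    rcases Finset.mem_union.1 hT with hT | hT
    · obtain ⟨i, hi, rfl⟩ := Finset.mem_image.1 hT
      exact hA i hi
    · obtain ⟨hTS, hT2⟩ := Finset.mem_powersetCard.1 hT
      obtain ⟨i, k, hik, rfl⟩ := Finset.card_eq_two.1 hT2
      exact hS i (hTS (by simp)) k (hTS (by simp)) hik
  have h1 := (Finset.card_le_card hsub).trans Finset.card_image_le
  rwa [Finset.card_union_of_disjoint hdisj, Finset.card_powersetCard,
    Finset.card_image_of_injective _ Finset.singleton_injective] at h1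

lemma support_eq_singleton {a : Fin n →₀ ℕ} (ha : a ≠ 0) {i : Fin n}
    (h : ∀ m, m ≠ i → a m = 0) : a.support = {i} := by
  have hi : a i ≠ 0 := by
    intro hi
    apply ha
    ext m
    by_cases hm : m = i
    · rw [hm]; exact hi
    · exact h m hm
  ext m
  rw [Finsupp.mem_support_iff, Finset.mem_singleton]
  exact ⟨fun hm => by by_contra hne; exact hm (h m hne), fun hm => hm ▸ hi⟩

/-- If one of the two entries vanished, the exponent would be a pure top power of the other
variable. -/
lemma support_eq_pair {D : ℕ} {i k : Fin n} (hi : ¬ HasTopExp α D {i})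
    (hk : ¬ HasTopExp α D {k}) {j : Fin (r + 1)} (hj : (α j).degree = D)
    (hsupp : ∀ m, m ∉ ({i, k} : Set (Fin n)) → α j m = 0) : (α j).support = {i, k} := by
  have key : ∀ i k : Fin n, ¬ HasTopExp α D {k} →
      (∀ m, m ∉ ({i, k} : Set (Fin n)) → α j m = 0) → α j i ≠ 0 := by
    intro i k hk hsupp h0
    refine hk ⟨j, hj, fun m hm => ?_⟩
    by_cases hmi : m = i
    · rw [hmi]; exact h0
    · exact hsupp m (by simpa [hmi] using hm)
  ext m
  rw [Finsupp.mem_support_iff, Finset.mem_insert, Finset.mem_singleton]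
  constructor
  · intro hm
    by_contra hne
    exact hm (hsupp m hne)
  · rintro (rfl | rfl)
    · exact key _ k hk hsupp
    · exact key _ i hi (by rwa [Set.pair_comm])

lemma le_three_of_choose_two_le {s : ℕ} (h : s.choose 2 ≤ s) : s ≤ 3 := by
  by_contra! hs
  obtain ⟨t, rfl⟩ : ∃ t, s = t + 4 := ⟨s - 4, by omega⟩
  rw [Nat.choose_two_right, Nat.div_le_iff_le_mul_add_pred two_pos] at h
  rw [show t + 4 - 1 = t + 3 by omega] at h
  norm_num at h
  nlinarith

lemma le_two_of_choose_two_le {s : ℕ} (h : s.choose 2 ≤ 1) : s ≤ 2 := by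
  by_contra! hs
  have h1 : Nat.choose 3 2 ≤ s.choose 2 := Nat.choose_le_choose 2 hs
  rw [show Nat.choose 3 2 = 3 from rfl] at h1
  omega

namespace IsNormalForm

lemma exists_degree_lt_of_constant (h : IsNormalForm f α β w c b p K ε)
    (hf : f.totalDegree = 2 * d) (hc : HasConstantTerm f) : ∃ j, (α j).degree < 2 * d := by
  obtain ⟨j, hj⟩ := h.hasConstantTerm_iff.1 hc
  refine ⟨j, ?_⟩
  rw [hj, map_zero, Nat.pos_iff_ne_zero]
  intro h0
  have hzero : ∀ k, α k = 0 := fun k => by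
    have := h.degree_le hf k
    rw [h0, Nat.le_zero, Finsupp.degree_eq_zero_iff] at this
    exact this
  have hinj := injective_of_affineIndependent h.simplex
  have : Nontrivial (Fin (r + 1)) := Fin.nontrivial_iff_two_le.2 (by have := h.r_pos; omega)
  obtain ⟨k, hk⟩ := exists_ne j
  exact hk (hinj (by rw [hzero, hzero]))

lemma encard_le_three_of_constant (h : IsNormalForm f α β w c b p K ε)
    (hf : f.totalDegree = 2 * d) (hc : HasConstantTerm f) :
    (zerosAtInfinity (homogenization d f)).encard ≤ 3 ∨
      (zerosAtInfinity (homogenization d f)).Infinite := by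
  classical
  have hlow := h.exists_degree_lt_of_constant hf hc
  by_cases htop : ∀ i k, i ≠ k → HasTopExp α (2 * d) {i, k}
  swap
  · push Not at htop
    obtain ⟨i, k, hik, hno⟩ := htop
    exact Or.inr (h.infinite_zerosAtInfinity hf hlow hik hno)
  left
  have hd : 2 * d ≠ 0 := by
    obtain ⟨k, hk⟩ := hlow
    omega
  obtain ⟨j₀, hj₀⟩ := h.hasConstantTerm_iff.1 hc
  have hne : ∀ j, (α j).degree = 2 * d → j ∈ Finset.univ.erase j₀ := by
    intro j hj
    rw [Finset.mem_erase]
    refine ⟨?_, Finset.mem_univ j⟩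
    rintro rfl
    rw [hj₀, map_zero] at hj
    exact hd hj.symm
  rw [h.encard_zerosAtInfinity hf hlow htop]
  set S : Finset (Fin n) := Finset.univ.filter fun i => ¬ HasTopExp α (2 * d) {i} with hS
  have hSset : {i | ¬ HasTopExp α (2 * d) {i}} = (S : Set (Fin n)) := by simp [hS]
  rw [hSset, Set.encard_coe_eq_coe_finsetCard]
  -- The index j₀ of the zero exponent is unavailable for top exponents, so only r remain.
  have hcard : Sᶜ.card + S.card.choose 2 ≤ (Finset.univ.erase j₀).card := by
    apply card_add_choose_le (α := α)
    · intro i hi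
      simp only [hS, Finset.mem_compl, Finset.mem_filter, Finset.mem_univ, true_and,
        not_not] at hi
      obtain ⟨j, hj, hsupp⟩ := hi
      refine ⟨j, hne j hj, support_eq_singleton ?_ hsupp⟩
      intro h0
      rw [h0, map_zero] at hj
      exact hd hj.symm
    · intro i hi k hk hik
      obtain ⟨j, hj, hsupp⟩ := htop i k hik
      exact ⟨j, hne j hj, support_eq_pair (by simpa [hS] using hi) (by simpa [hS] using hk) hj
        hsupp⟩
  have h1 := Finset.card_add_card_compl S
  have h2 := h.r_le
  rw [Finset.card_erase_of_mem (Finset.mem_univ _), Finset.card_univ, Fintype.card_fin] at hcard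
  rw [Fintype.card_fin] at h1
  have := le_three_of_choose_two_le (s := S.card) (by omega)
  exact_mod_cast this

end IsNormalForm

namespace IsNormalForm

variable {α : Fin (n + 1) → Fin n →₀ ℕ} {w c : Fin (n + 1) → ℝ}

lemma encard_le_two_of_no_constant (h : IsNormalForm f α β w c b p K ε) (hn : 2 ≤ n)
    (hf : f.totalDegree = 2 * d) (hc : ¬ HasConstantTerm f) (hax : ∀ i, HasAxisExp α i) :
    (zerosAtInfinity (homogenization d f)).encard ≤ 2 ∨
      (zerosAtInfinity (homogenization d f)).Infinite := by
  classical
  have hlow := h.exists_degree_lt (by omega) (h.degree_le hf)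
  by_cases htop : ∀ i k, i ≠ k → HasTopExp α (2 * d) {i, k}
  swap
  · push Not at htop
    obtain ⟨i, k, hik, hno⟩ := htop
    exact Or.inr (h.infinite_zerosAtInfinity hf hlow hik hno)
  left
  rw [h.encard_zerosAtInfinity hf hlow htop]
  set S : Finset (Fin n) := Finset.univ.filter fun i => ¬ HasTopExp α (2 * d) {i} with hS
  have hSset : {i | ¬ HasTopExp α (2 * d) {i}} = (S : Set (Fin n)) := by simp [hS]
  rw [hSset, Set.encard_coe_eq_coe_finsetCard]
  -- The singletons now come from the axes, all n of them and of any degree; only the pairs need top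
  -- degree.
  have hcard : (Finset.univ : Finset (Fin n)).card + S.card.choose 2 ≤
      (Finset.univ : Finset (Fin (n + 1))).card := by
    apply card_add_choose_le (α := α)
    · intro i _
      obtain ⟨j, hj⟩ := hax i
      exact ⟨j, Finset.mem_univ j, support_eq_singleton
        (fun h0 => hc (h.hasConstantTerm_iff.2 ⟨j, h0⟩)) hj⟩
    · intro i hi k hk hik
      obtain ⟨j, hj, hsupp⟩ := htop i k hik
      exact ⟨j, Finset.mem_univ j, support_eq_pair (by simpa [hS] using hi)
        (by simpa [hS] using hk) hj hsupp⟩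
  simp only [Finset.card_univ, Fintype.card_fin] at hcard
  have := le_two_of_choose_two_le (s := S.card) (by omega)
  exact_mod_cast this

end IsNormalForm

/-! ### Two variables, and the two classification theorems -/

namespace IsNormalForm

variable {f : MvPolynomial (Fin 2) ℝ} {α : Fin (2 + 1) → Fin 2 →₀ ℕ} {β : Fin 2 →₀ ℕ}
  {w c : Fin (2 + 1) → ℝ} {p : Fin 2 → ℝ}

lemma hasTopExp_pair (h : IsNormalForm f α β w c b p K ε) (hf : f.totalDegree = 2 * d)
    (i k : Fin 2) (hik : i ≠ k) : HasTopExp α (2 * d) {i, k} := by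
  obtain ⟨j, hj⟩ := h.exists_degree_eq hf
  refine ⟨j, hj, fun m hm => absurd ?_ hm⟩
  rw [Set.mem_insert_iff, Set.mem_singleton_iff]
  omega

lemma encard_zerosAtInfinity_le_two (h : IsNormalForm f α β w c b p K ε)
    (hf : f.totalDegree = 2 * d) : (zerosAtInfinity (homogenization d f)).encard ≤ 2 := by
  rw [h.encard_zerosAtInfinity hf (h.exists_degree_lt two_pos (h.degree_le hf))
    (h.hasTopExp_pair hf)]
  refine (Set.encard_le_encard (Set.subset_univ _)).trans ?_
  simp

lemma encard_torusZeros_of_even (h : IsNormalForm f α β w c b p K ε) (hβ : IsEvenExp β) :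
    (torusZeros f).encard = 4 := by
  rw [h.encard_torusZeros, h.sign hβ, encard_signs_even hβ]

lemma encard_torusZeros_of_odd (h : IsNormalForm f α β w c b p K ε) (hβ : ¬ IsEvenExp β) :
    (torusZeros f).encard = 2 := by
  rw [h.encard_torusZeros, encard_signs_odd hβ]

end IsNormalForm

lemma add_mem_of_le_two {m e : ℕ∞} (he : e ≤ 2) : m + e ∈ ({m, m + 1, m + 2} : Set ℕ∞) := by
  lift e to ℕ using ne_top_of_le_ne_top (by simp) he
  have he : e ≤ 2 := by exact_mod_cast he
  interval_cases e <;> simp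

theorem bivariate_zeros {f : MvPolynomial (Fin 2) ℝ} {α : Fin (r + 1) → Fin 2 →₀ ℕ}
    {β : Fin 2 →₀ ℕ} (hf : IsBoundaryCircuit d f r α β) :
    (HasConstantTerm f → ¬ IsDegenerate f →
      (IsEvenExp β → (affineZeros f).encard = 4 ∧
        (projZeros (homogenization d f)).encard ∈ ({4, 5, 6} : Set ℕ∞)) ∧
      (¬ IsEvenExp β → (affineZeros f).encard = 2 ∧
        (projZeros (homogenization d f)).encard ∈ ({2, 3, 4} : Set ℕ∞))) ∧
    (¬ HasConstantTerm f →
      (IsEvenExp β →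
        ((affineZeros f).encard = 5 ∧
          (projZeros (homogenization d f)).encard ∈ ({5, 6, 7} : Set ℕ∞)) ∨
        ((affineZeros f).encard = ⊤ ∧ (projZeros (homogenization d f)).encard = ⊤)) ∧
      (¬ IsEvenExp β →
        ((affineZeros f).encard = 3 ∧
          (projZeros (homogenization d f)).encard ∈ ({3, 4, 5} : Set ℕ∞)) ∨
        ((affineZeros f).encard = ⊤ ∧ (projZeros (homogenization d f)).encard = ⊤))) ∧
    ((affineZeros f).Finite → (zerosAtInfinity (homogenization d f)).encard ≤ 2) := by
  obtain ⟨w, c, b, p, K, ε, h⟩ := hf.exists_normalForm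
  have hproj := encard_projZeros hf.degree.le
  have hmem : ∀ m : ℕ∞, (affineZeros f).encard = m →
      (zerosAtInfinity (homogenization d f)).encard ≤ 2 →
      (projZeros (homogenization d f)).encard ∈ ({m, m + 1, m + 2} : Set ℕ∞) := by
    intro m hm hinf
    rw [hproj, hm]
    exact add_mem_of_le_two hinf
  have hinfinite : (affineZeros f).Infinite →
      (affineZeros f).encard = ⊤ ∧ (projZeros (homogenization d f)).encard = ⊤ := by
    intro hi
    rw [hproj, hi.encard_eq]
    simp
  rcases h.r_le.lt_or_eq with hr | rfl
  -- For r < 2 there are infinitely many zeros and the polytope is not full-dimensional: the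
  -- degenerate case.
  · have hi := h.infinite_of_lt hr
    refine ⟨fun _ hnd => absurd ⟨hi, fun hfull => ?_⟩ hnd, fun _ => ⟨fun _ => Or.inr (hinfinite hi),
      fun _ => Or.inr (hinfinite hi)⟩, fun hfin => absurd hfin hi⟩
    exact hr.ne (h.isFullDim_iff.1 hfull)
  · have hinf := h.encard_zerosAtInfinity_le_two hf.degree
    refine ⟨fun hc _ => ?_, fun hc => ?_, fun _ => hinf⟩
    · rw [h.affineZeros_of_constant hc] at hmem ⊢
      exact ⟨fun hβ => ⟨h.encard_torusZeros_of_even hβ,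
          hmem 4 (h.encard_torusZeros_of_even hβ) hinf⟩,
        fun hβ => ⟨h.encard_torusZeros_of_odd hβ, hmem 2 (h.encard_torusZeros_of_odd hβ) hinf⟩⟩
    · by_cases hax : ∀ i, HasAxisExp α i
      · have h1 := h.encard_affineZeros_of_axes two_pos hc hax
        refine ⟨fun hβ => Or.inl ?_, fun hβ => Or.inl ?_⟩
        · rw [h.encard_torusZeros_of_even hβ] at h1
          exact ⟨h1, hmem 5 h1 hinf⟩
        · rw [h.encard_torusZeros_of_odd hβ] at h1
          exact ⟨h1, hmem 3 h1 hinf⟩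
      · push Not at hax
        obtain ⟨i, hi⟩ := hax
        have hi := h.infinite_of_missing_axis le_rfl hi
        exact ⟨fun _ => Or.inr (hinfinite hi), fun _ => Or.inr (hinfinite hi)⟩

theorem multivariate_zeros (hn : 2 < n) (hf : IsBoundaryCircuit d f r α β) :
    (projZeros (homogenization d f)).encard =
      (affineZeros f).encard + (zerosAtInfinity (homogenization d f)).encard ∧
    (HasConstantTerm f →
      (zerosAtInfinity (homogenization d f)).encard ≤ 3 ∨
      (zerosAtInfinity (homogenization d f)).Infinite) ∧
    (¬ HasConstantTerm f →
      (zerosAtInfinity (homogenization d f)).encard ≤ 2 ∨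
      (zerosAtInfinity (homogenization d f)).Infinite ∨
      (affineZeros f).Infinite) := by
  obtain ⟨w, c, b, p, K, ε, h⟩ := hf.exists_normalForm
  refine ⟨encard_projZeros hf.degree.le, h.encard_le_three_of_constant hf.degree, fun hc => ?_⟩
  rcases h.r_le.lt_or_eq with hr | rfl
  · exact Or.inr (Or.inr (h.infinite_of_lt hr))
  · by_cases hax : ∀ i, HasAxisExp α i
    · exact (h.encard_le_two_of_no_constant hn.le hf.degree hc hax).imp_right Or.inl
    · push Not at hax
      obtain ⟨i, hi⟩ := hax
      exact Or.inr (Or.inr (h.infinite_of_missing_axis hn.le hi))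

end

section

variable {n d : ℕ}

/-! ### Examples from lattice simplices -/

/-- `γ` are the vertices of a full-dimensional lattice simplex, the largest degree of a vertex
being `D > 0`. -/
structure IsLatticeSimplex (γ : Fin (n + 1) → Fin n → ℕ) (D : ℕ) : Prop where
  indep : ∀ u : Fin (n + 1) → ℝ, ∑ j, u j = 0 → (∀ i, ∑ j, u j * γ j i = 0) → u = 0
  pos : 0 < D
  degree_le : ∀ j, ∑ i, γ j i ≤ D
  degree_eq : ∃ j, ∑ i, γ j i = D

/-- Some vertex of degree `D` is supported on the coordinates `i` and `k`. -/
def HasTopVertex (γ : Fin (n + 1) → Fin n → ℕ) (D : ℕ) (i k : Fin n) : Prop :=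
  ∃ j, ∑ l, γ j l = D ∧ ∀ m, m ≠ i → m ≠ k → γ j m = 0

instance (γ : Fin (n + 1) → Fin n → ℕ) (D : ℕ) (i k : Fin n) :
    Decidable (HasTopVertex γ D i k) :=
  inferInstanceAs (Decidable (∃ j, ∑ l, γ j l = D ∧ ∀ m, m ≠ i → m ≠ k → γ j m = 0))

/-- Every coordinate axis contains a vertex. -/
def HasAxisVertices (γ : Fin (n + 1) → Fin n → ℕ) : Prop :=
  ∀ i, ∃ j, ∀ k, k ≠ i → γ j k = 0

instance (γ : Fin (n + 1) → Fin n → ℕ) : Decidable (HasAxisVertices γ) :=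
  inferInstanceAs (Decidable (∀ i, ∃ j, ∀ k, k ≠ i → γ j k = 0))

/-- The dilates by `M` of the vertices. -/
def dilate (M : ℕ) (γ : Fin (n + 1) → Fin n → ℕ) (j : Fin (n + 1)) : Fin n →₀ ℕ :=
  Finsupp.equivFunOnFinite.symm fun i => M * γ j i

/-- The integral combination of the vertices with coefficients `m`. -/
def combine (m : Fin (n + 1) → ℕ) (γ : Fin (n + 1) → Fin n → ℕ) : Fin n →₀ ℕ :=
  Finsupp.equivFunOnFinite.symm fun i => ∑ j, m j * γ j i

@[simp]
lemma dilate_apply (M : ℕ) (γ : Fin (n + 1) → Fin n → ℕ) (j : Fin (n + 1)) (i : Fin n) :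
    dilate M γ j i = M * γ j i := rfl

@[simp]
lemma combine_apply (m : Fin (n + 1) → ℕ) (γ : Fin (n + 1) → Fin n → ℕ) (i : Fin n) :
    combine m γ i = ∑ j, m j * γ j i := rfl

lemma degree_dilate (M : ℕ) (γ : Fin (n + 1) → Fin n → ℕ) (j : Fin (n + 1)) :
    (dilate M γ j).degree = M * ∑ i, γ j i := by
  simp [Finsupp.degree_eq_sum, Finset.mul_sum]

variable {M D : ℕ} {γ : Fin (n + 1) → Fin n → ℕ}

lemma exists_dilate_eq_zero_iff (hM : 0 < M) :
    (∃ j, dilate M γ j = 0) ↔ ∃ j, γ j = 0 := by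
  refine exists_congr fun j => ?_
  rw [DFunLike.ext_iff, funext_iff]
  simp [hM.ne']

lemma hasAxisExp_dilate_iff (hM : 0 < M) :
    (∀ i, HasAxisExp (dilate M γ) i) ↔ HasAxisVertices γ := by
  simp [HasAxisExp, HasAxisVertices, hM.ne']

lemma hasTopExp_dilate_pair_iff (hM : 0 < M) (i k : Fin n) :
    HasTopExp (dilate M γ) (M * D) {i, k} ↔ HasTopVertex γ D i k := by
  simp [HasTopExp, HasTopVertex, degree_dilate, hM.ne']

lemma hasTopExp_dilate_singleton_iff (hM : 0 < M) (i : Fin n) :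
    HasTopExp (dilate M γ) (M * D) {i} ↔ HasTopVertex γ D i i := by
  rw [← hasTopExp_dilate_pair_iff hM, Set.pair_eq_singleton]

/-- Dilating by M = ∑ m_j makes ∑ m_j γ_j the convex combination of the vertices M γ_j with weights
m_j / M; M even makes these vertices even. -/
lemma IsLatticeSimplex.isSimplexPoint (hγ : IsLatticeSimplex γ D) {m : Fin (n + 1) → ℕ}
    (hm : ∀ j, 0 < m j) (hM : Even (∑ j, m j)) :
    IsSimplexPoint (dilate (∑ j, m j) γ) (combine m γ)
      (fun j => (m j : ℝ) / ((∑ j, m j : ℕ) : ℝ)) := by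
  have hpos : 0 < ∑ j, m j := Finset.sum_pos (fun j _ => hm j) Finset.univ_nonempty
  set M := ∑ j, m j with hMdef
  have hne : (M : ℝ) ≠ 0 := by exact_mod_cast hpos.ne'
  refine ⟨fun j i => by simpa using hM.mul_right _, ?_, fun j => ?_, ?_, fun i => ?_⟩
  · rw [affineIndependent_toPoint_iff]
    intro u hu hs
    refine hγ.indep u hu fun i => ?_
    have := hs i
    simp only [dilate_apply, Nat.cast_mul, mul_left_comm _ (M : ℝ), ← Finset.mul_sum,
      mul_eq_zero, hne, false_or] at this
    exact this
  · exact div_pos (by exact_mod_cast hm j) (by exact_mod_cast hpos)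
  · rw [← Finset.sum_div, ← Nat.cast_sum, ← hMdef, div_self hne]
  · simp only [combine_apply, Nat.cast_sum, Nat.cast_mul, dilate_apply]
    refine Finset.sum_congr rfl fun j _ => ?_
    field_simp

/-- A lattice simplex and positive integral weights with even sum yield a boundary nonnegative
circuit polynomial. -/
theorem IsLatticeSimplex.occurs (hγ : IsLatticeSimplex γ D) (hn : 0 < n) {m : Fin (n + 1) → ℕ}
    (hm : ∀ j, 0 < m j) (hM : Even (∑ j, m j))
    {Q : ℕ → MvPolynomial (Fin n) ℝ → (Fin n →₀ ℕ) → Prop}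
    (hQ : ∀ (M d : ℕ) (f : MvPolynomial (Fin n) ℝ) (w c : Fin (n + 1) → ℝ) (b : ℝ) (p : Fin n → ℝ)
      (K : ℝ) (ε : ℤˣ), 0 < M → 2 * d = M * D → f.totalDegree = 2 * d →
      IsNormalForm f (dilate M γ) (combine m γ) w c b p K ε → Q d f (combine m γ)) :
    Occurs n Q := by
  have hpos : 0 < ∑ j, m j := Finset.sum_pos (fun j _ => hm j) Finset.univ_nonempty
  have h := hγ.isSimplexPoint hm hM
  obtain ⟨d, hd⟩ : ∃ d, 2 * d = (∑ j, m j) * D := by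
    obtain ⟨d, hd⟩ := hM.mul_right D
    exact ⟨d, by omega⟩
  obtain ⟨k, hk⟩ := hγ.degree_eq
  have hB := h.isBoundaryCircuit (d := d) hn
    (fun j => by rw [degree_dilate, hd]; exact Nat.mul_le_mul_left _ (hγ.degree_le j)) k
    (by rw [degree_dilate, hk, hd])
  obtain ⟨w, c, b, p, K, ε, hN⟩ := hB.exists_normalForm
  exact ⟨d, _, n, _, _, hB, hN.isFullDim_iff.2 rfl,
    hQ _ d _ w c b p K ε hpos hd hB.degree hN⟩

lemma IsNormalForm.encard_zerosAtInfinity_dilate {f : MvPolynomial (Fin n) ℝ} {β : Fin n →₀ ℕ}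
    {w c : Fin (n + 1) → ℝ} {b K : ℝ} {p : Fin n → ℝ} {ε : ℤˣ} (hn : 0 < n)
    (h : IsNormalForm f (dilate M γ) β w c b p K ε) (hM : 0 < M) (hd : 2 * d = M * D)
    (hf : f.totalDegree = 2 * d) (htop : ∀ i k, i ≠ k → HasTopVertex γ D i k) :
    (zerosAtInfinity (homogenization d f)).encard = {i | ¬ HasTopVertex γ D i i}.encard := by
  rw [h.encard_zerosAtInfinity hf (h.exists_degree_lt hn (h.degree_le hf))
    (fun i k hik => by rw [hd, hasTopExp_dilate_pair_iff hM]; exact htop i k hik)]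
  simp only [hd, hasTopExp_dilate_singleton_iff hM]

lemma IsNormalForm.infinite_zerosAtInfinity_dilate {f : MvPolynomial (Fin n) ℝ}
    {β : Fin n →₀ ℕ} {w c : Fin (n + 1) → ℝ} {b K : ℝ} {p : Fin n → ℝ} {ε : ℤˣ} (hn : 0 < n)
    (h : IsNormalForm f (dilate M γ) β w c b p K ε) (hM : 0 < M) (hd : 2 * d = M * D)
    (hf : f.totalDegree = 2 * d) (htop : ∃ i k, i ≠ k ∧ ¬ HasTopVertex γ D i k) :
    (zerosAtInfinity (homogenization d f)).Infinite := by
  obtain ⟨i, k, hik, hno⟩ := htop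
  exact h.infinite_zerosAtInfinity hf (h.exists_degree_lt hn (h.degree_le hf)) hik
    (by rwa [hd, hasTopExp_dilate_pair_iff hM])

/-! ### Bivariate examples -/

section Bivariate

variable {γ : Fin (2 + 1) → Fin 2 → ℕ}

lemma combine_even (γ : Fin (2 + 1) → Fin 2 → ℕ) : IsEvenExp (combine ![4, 2, 2] γ) := by
  intro i
  rw [combine_apply, Fin.sum_univ_three]
  change Even (4 * γ 0 i + 2 * γ 1 i + 2 * γ 2 i)
  exact ⟨2 * γ 0 i + γ 1 i + γ 2 i, by ring⟩

/-- The weights 2, 1, 1 leave the parity of γ 1 + γ 2; the doubled weights 4, 2, 2 give the even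
counterpart. -/
lemma combine_odd (h : ∃ i, Odd (γ 1 i + γ 2 i)) : ¬ IsEvenExp (combine ![2, 1, 1] γ) := by
  obtain ⟨i, hi⟩ := h
  intro he
  have := he i
  rw [combine_apply, Fin.sum_univ_three] at this
  change Even (2 * γ 0 i + 1 * γ 1 i + 1 * γ 2 i) at this
  rw [← Nat.not_even_iff_odd] at hi
  apply hi
  rw [Nat.even_iff] at this ⊢
  omega

/-- The number of zeros at infinity of the polynomials coming from a bivariate simplex. -/
abbrev topCount (γ : Fin (2 + 1) → Fin 2 → ℕ) (D : ℕ) : ℕ :=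
  (Finset.univ.filter fun i => ¬ HasTopVertex γ D i i).card

lemma IsNormalForm.encard_projZeros_dilate {f : MvPolynomial (Fin 2) ℝ} {β : Fin 2 →₀ ℕ}
    {w c : Fin (2 + 1) → ℝ} {b K : ℝ} {p : Fin 2 → ℝ} {ε : ℤˣ}
    (h : IsNormalForm f (dilate M γ) β w c b p K ε) (hγ : IsLatticeSimplex γ D) (hM : 0 < M)
    (hd : 2 * d = M * D) (hf : f.totalDegree = 2 * d) :
    (projZeros (homogenization d f)).encard = (affineZeros f).encard + topCount γ D := by
  rw [encard_projZeros hf.le, h.encard_zerosAtInfinity_dilate two_pos hM hd hf]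
  · congr 1
    rw [← Set.encard_coe_eq_coe_finsetCard]
    simp
  · intro i k hik
    obtain ⟨j, hj⟩ := hγ.degree_eq
    exact ⟨j, hj, fun m h1 h2 => by omega⟩

lemma occurs_constant (hγ : IsLatticeSimplex γ D) (hodd : ∃ i, Odd (γ 1 i + γ 2 i))
    (hc : ∃ j, γ j = 0) :
    Occurs 2 (fun d f β => HasConstantTerm f ∧ IsEvenExp β ∧
      (projZeros (homogenization d f)).encard = 4 + topCount γ D) ∧
    Occurs 2 (fun d f β => HasConstantTerm f ∧ ¬ IsEvenExp β ∧
      (projZeros (homogenization d f)).encard = 2 + topCount γ D) := by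
  constructor
  · refine hγ.occurs two_pos (m := ![4, 2, 2]) (by decide) (by decide) ?_
    intro M d f w c b p K ε hM hd hf h
    have hc' := h.hasConstantTerm_iff.2 ((exists_dilate_eq_zero_iff hM).2 hc)
    refine ⟨hc', combine_even γ, ?_⟩
    rw [h.encard_projZeros_dilate hγ hM hd hf, h.affineZeros_of_constant hc',
      h.encard_torusZeros_of_even (combine_even γ)]
  · refine hγ.occurs two_pos (m := ![2, 1, 1]) (by decide) (by decide) ?_
    intro M d f w c b p K ε hM hd hf h
    have hc' := h.hasConstantTerm_iff.2 ((exists_dilate_eq_zero_iff hM).2 hc)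
    refine ⟨hc', combine_odd hodd, ?_⟩
    rw [h.encard_projZeros_dilate hγ hM hd hf, h.affineZeros_of_constant hc',
      h.encard_torusZeros_of_odd (combine_odd hodd)]

lemma occurs_no_constant (hγ : IsLatticeSimplex γ D) (hodd : ∃ i, Odd (γ 1 i + γ 2 i))
    (hc : ¬ ∃ j, γ j = 0) (hax : HasAxisVertices γ) :
    Occurs 2 (fun d f β => ¬ HasConstantTerm f ∧ IsEvenExp β ∧
      (projZeros (homogenization d f)).encard = 5 + topCount γ D) ∧
    Occurs 2 (fun d f β => ¬ HasConstantTerm f ∧ ¬ IsEvenExp β ∧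
      (projZeros (homogenization d f)).encard = 3 + topCount γ D) := by
  constructor
  · refine hγ.occurs two_pos (m := ![4, 2, 2]) (by decide) (by decide) ?_
    intro M d f w c b p K ε hM hd hf h
    have hc' := mt h.hasConstantTerm_iff.1 (mt (exists_dilate_eq_zero_iff hM).1 hc)
    refine ⟨hc', combine_even γ, ?_⟩
    rw [h.encard_projZeros_dilate hγ hM hd hf, h.encard_affineZeros_of_axes two_pos hc'
      ((hasAxisExp_dilate_iff hM).2 hax), h.encard_torusZeros_of_even (combine_even γ)]
    rfl
  · refine hγ.occurs two_pos (m := ![2, 1, 1]) (by decide) (by decide) ?_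
    intro M d f w c b p K ε hM hd hf h
    have hc' := mt h.hasConstantTerm_iff.1 (mt (exists_dilate_eq_zero_iff hM).1 hc)
    refine ⟨hc', combine_odd hodd, ?_⟩
    rw [h.encard_projZeros_dilate hγ hM hd hf, h.encard_affineZeros_of_axes two_pos hc'
      ((hasAxisExp_dilate_iff hM).2 hax), h.encard_torusZeros_of_odd (combine_odd hodd)]
    rfl

lemma occurs_infinite (hγ : IsLatticeSimplex γ D) (hodd : ∃ i, Odd (γ 1 i + γ 2 i))
    (hc : ¬ ∃ j, γ j = 0) (hax : ¬ HasAxisVertices γ) :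
    Occurs 2 (fun _ f β => ¬ HasConstantTerm f ∧ IsEvenExp β ∧ (affineZeros f).Infinite) ∧
    Occurs 2 (fun _ f β => ¬ HasConstantTerm f ∧ ¬ IsEvenExp β ∧ (affineZeros f).Infinite) := by
  have hinf : ∀ (M : ℕ) (f : MvPolynomial (Fin 2) ℝ) (β : Fin 2 →₀ ℕ) (w c : Fin (2 + 1) → ℝ)
      (b : ℝ) (p : Fin 2 → ℝ) (K : ℝ) (ε : ℤˣ), 0 < M →
      IsNormalForm f (dilate M γ) β w c b p K ε →
      ¬ HasConstantTerm f ∧ (affineZeros f).Infinite := by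
    intro M f β w c b p K ε hM h
    refine ⟨mt h.hasConstantTerm_iff.1 (mt (exists_dilate_eq_zero_iff hM).1 hc), ?_⟩
    have := mt (hasAxisExp_dilate_iff hM).1 hax
    push Not at this
    obtain ⟨i, hi⟩ := this
    exact h.infinite_of_missing_axis le_rfl hi
  constructor
  · refine hγ.occurs two_pos (m := ![4, 2, 2]) (by decide) (by decide) ?_
    intro M d f w c b p K ε hM hd hf h
    have := hinf M f _ w c b p K ε hM h
    exact ⟨this.1, combine_even γ, this.2⟩
  · refine hγ.occurs two_pos (m := ![2, 1, 1]) (by decide) (by decide) ?_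
    intro M d f w c b p K ε hM hd hf h
    have := hinf M f _ w c b p K ε hM h
    exact ⟨this.1, combine_odd hodd, this.2⟩

/-- A triangle whose edge vectors at the first vertex have nonzero determinant. -/
lemma isLatticeSimplex_of_det (hpos : 0 < D)
    (hdet : ((γ 1 0 : ℤ) - γ 0 0) * ((γ 2 1 : ℤ) - γ 0 1) -
      ((γ 1 1 : ℤ) - γ 0 1) * ((γ 2 0 : ℤ) - γ 0 0) ≠ 0)
    (hle : ∀ j, ∑ i, γ j i ≤ D) (heq : ∃ j, ∑ i, γ j i = D) : IsLatticeSimplex γ D := by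
  refine ⟨fun u hu hs => ?_, hpos, hle, heq⟩
  have hx := hs 0
  have hy := hs 1
  rw [Fin.sum_univ_three] at hu hx hy
  have hdet' : ((γ 1 0 : ℝ) - γ 0 0) * ((γ 2 1 : ℝ) - γ 0 1) -
      ((γ 1 1 : ℝ) - γ 0 1) * ((γ 2 0 : ℝ) - γ 0 0) ≠ 0 := by exact_mod_cast hdet
  have h1 : u 1 = 0 := by
    refine (mul_eq_zero.1 ?_).resolve_right hdet'
    -- Cramer's rule: eliminate u 0 and u 2, leaving u 1 times the determinant.
    linear_combination ((γ 2 1 : ℝ) - γ 0 1) * hx - ((γ 2 0 : ℝ) - γ 0 0) * hy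
      - (((γ 2 1 : ℝ) - γ 0 1) * γ 0 0 - ((γ 2 0 : ℝ) - γ 0 0) * γ 0 1) * hu
  have h2 : u 2 = 0 := by
    refine (mul_eq_zero.1 ?_).resolve_right hdet'
    linear_combination ((γ 1 0 : ℝ) - γ 0 0) * hy - ((γ 1 1 : ℝ) - γ 0 1) * hx
      - (((γ 1 0 : ℝ) - γ 0 0) * γ 0 1 - ((γ 1 1 : ℝ) - γ 0 1) * γ 0 0) * hu
  funext j
  fin_cases j
  · simpa [h1, h2] using hu
  · exact h1
  · exact h2

theorem bivariate_occurs (k : ℕ) (hk : k ≤ 2) :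
    Occurs 2 (fun d f β => HasConstantTerm f ∧ IsEvenExp β ∧
      (projZeros (homogenization d f)).encard = 4 + k) ∧
    Occurs 2 (fun d f β => HasConstantTerm f ∧ ¬ IsEvenExp β ∧
      (projZeros (homogenization d f)).encard = 2 + k) ∧
    Occurs 2 (fun d f β => ¬ HasConstantTerm f ∧ IsEvenExp β ∧
      (projZeros (homogenization d f)).encard = 5 + k) ∧
    Occurs 2 (fun d f β => ¬ HasConstantTerm f ∧ ¬ IsEvenExp β ∧
      (projZeros (homogenization d f)).encard = 3 + k) := by
  suffices h : ∃ (γ γ' : Fin (2 + 1) → Fin 2 → ℕ) (D D' : ℕ),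
      (IsLatticeSimplex γ D ∧ (∃ i, Odd (γ 1 i + γ 2 i)) ∧ (∃ j, γ j = 0) ∧ topCount γ D = k) ∧
      (IsLatticeSimplex γ' D' ∧ (∃ i, Odd (γ' 1 i + γ' 2 i)) ∧ (¬ ∃ j, γ' j = 0) ∧
        HasAxisVertices γ' ∧ topCount γ' D' = k) by
    obtain ⟨γ, γ', D, D', ⟨h1, h2, h3, h4⟩, h5, h6, h7, h8, h9⟩ := h
    have ha := occurs_constant h1 h2 h3
    have hb := occurs_no_constant h5 h6 h7 h8
    rw [h4] at ha
    rw [h9] at hb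
    exact ⟨ha.1, ha.2, hb.1, hb.2⟩
  interval_cases k
  -- Both axes carry a vertex of top degree.
  · exact ⟨![![0, 0], ![1, 0], ![0, 1]], ![![2, 0], ![0, 2], ![1, 0]], 1, 2,
      ⟨isLatticeSimplex_of_det (by decide) (by decide) (by decide) (by decide),
        by decide, by decide, by decide⟩,
      isLatticeSimplex_of_det (by decide) (by decide) (by decide) (by decide),
      by decide, by decide, by decide, by decide⟩
  -- Only the first axis carries a vertex of top degree.
  · exact ⟨![![0, 0], ![2, 0], ![0, 1]], ![![1, 0], ![2, 0], ![0, 1]], 2, 2,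
      ⟨isLatticeSimplex_of_det (by decide) (by decide) (by decide) (by decide),
        by decide, by decide, by decide⟩,
      isLatticeSimplex_of_det (by decide) (by decide) (by decide) (by decide),
      by decide, by decide, by decide, by decide⟩
  -- The only top vertex is the mixed one (1, 1).
  · exact ⟨![![0, 0], ![1, 1], ![1, 0]], ![![1, 1], ![1, 0], ![0, 1]], 2, 2,
      ⟨isLatticeSimplex_of_det (by decide) (by decide) (by decide) (by decide),
        by decide, by decide, by decide⟩,
      isLatticeSimplex_of_det (by decide) (by decide) (by decide) (by decide),
      by decide, by decide, by decide, by decide⟩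

/-- All vertices involve the first variable, so the polynomial vanishes on the second axis. -/
theorem bivariate_occurs_infinite :
    Occurs 2 (fun _ f β => ¬ HasConstantTerm f ∧ IsEvenExp β ∧ (affineZeros f).Infinite) ∧
    Occurs 2 (fun _ f β => ¬ HasConstantTerm f ∧ ¬ IsEvenExp β ∧ (affineZeros f).Infinite) :=
  occurs_infinite (γ := ![![1, 0], ![2, 0], ![1, 1]]) (D := 2)
    (isLatticeSimplex_of_det (by decide) (by decide) (by decide) (by decide))
    (by decide) (by decide) (by decide)

end Bivariate

/-! ### Examples in higher dimension -/

/-- The pyramid over a simplex whose apex is `D` times a new unit vector. -/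
def pyramid (γ : Fin (n + 1) → Fin n → ℕ) (D : ℕ) : Fin (n + 1 + 1) → Fin (n + 1) → ℕ :=
  Fin.cons (Fin.cons D 0) fun j => Fin.cons 0 (γ j)

/-- Only the apex has a nonzero new coordinate, so its coefficient in any affine relation vanishes;
its degree is D, so the top degree is unchanged. -/
lemma IsLatticeSimplex.pyramid (hγ : IsLatticeSimplex γ D) :
    IsLatticeSimplex (pyramid γ D) D := by
  have hdeg : ∀ j, ∑ i, CircuitZeros.pyramid γ D (Fin.succ j) i = ∑ i, γ j i := fun j => by
    simp [CircuitZeros.pyramid, Fin.sum_univ_succ (n := n)]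
  refine ⟨fun u hu hs => ?_, hγ.pos, fun j => ?_, ?_⟩
  · have h0 : u 0 = 0 := by
      have := hs 0
      rw [Fin.sum_univ_succ] at this
      simpa [CircuitZeros.pyramid, hγ.pos.ne'] using this
    have h1 : (fun j : Fin (n + 1) => u j.succ) = 0 := by
      refine hγ.indep _ ?_ fun i => ?_
      · rw [Fin.sum_univ_succ, h0, zero_add] at hu
        exact hu
      · have := hs i.succ
        rw [Fin.sum_univ_succ, h0, zero_mul, zero_add] at this
        simpa [CircuitZeros.pyramid] using this
    funext j
    refine Fin.cases h0 (fun j => congrFun h1 j) j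
  · refine Fin.cases ?_ (fun j => ?_) j
    · simp [CircuitZeros.pyramid, Fin.sum_univ_succ (n := n)]
    · rw [hdeg]
      exact hγ.degree_le j
  · obtain ⟨j, hj⟩ := hγ.degree_eq
    exact ⟨j.succ, by rw [hdeg, hj]⟩

lemma exists_pyramid_eq_zero_iff (hD : 0 < D) : (∃ j, pyramid γ D j = 0) ↔ ∃ j, γ j = 0 := by
  simp [Fin.exists_fin_succ (n := n + 1), pyramid, funext_iff, Fin.forall_fin_succ (n := n),
    hD.ne']

lemma hasAxisVertices_pyramid (hγ : HasAxisVertices γ) : HasAxisVertices (pyramid γ D) := by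
  intro i
  refine Fin.cases ⟨0, ?_⟩ (fun i => ?_) i
  · intro k hk
    obtain ⟨k, rfl⟩ := Fin.exists_succ_eq_of_ne_zero hk
    simp [pyramid]
  · obtain ⟨j, hj⟩ := hγ i
    refine ⟨j.succ, fun k => Fin.cases (fun _ => by simp [pyramid]) (fun k hk => ?_) k⟩
    simpa [pyramid] using hj k (fun h => hk (by rw [h]))

lemma hasTopVertex_pyramid_zero (i : Fin (n + 1)) : HasTopVertex (pyramid γ D) D i 0 := by
  refine ⟨0, by simp [pyramid, Fin.sum_univ_succ (n := n)], fun m _ hm => ?_⟩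
  obtain ⟨k, rfl⟩ := Fin.exists_succ_eq_of_ne_zero hm
  simp [pyramid]

lemma hasTopVertex_comm {i k : Fin n} (h : HasTopVertex γ D i k) : HasTopVertex γ D k i := by
  obtain ⟨j, hj, hs⟩ := h
  exact ⟨j, hj, fun m h1 h2 => hs m h2 h1⟩

lemma hasTopVertex_pyramid_succ_iff (hD : 0 < D) (i k : Fin n) :
    HasTopVertex (pyramid γ D) D i.succ k.succ ↔ HasTopVertex γ D i k := by
  have h0 : (0 : Fin (n + 1)) ≠ i.succ ∧ (0 : Fin (n + 1)) ≠ k.succ :=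
    ⟨(Fin.succ_ne_zero i).symm, (Fin.succ_ne_zero k).symm⟩
  simp [HasTopVertex, Fin.exists_fin_succ (n := n + 1), pyramid, Fin.forall_fin_succ (n := n),
    Fin.sum_univ_succ (n := n), hD.ne', h0.1, h0.2]

lemma pyramid_top_pairs (htop : ∀ i k, i ≠ k → HasTopVertex γ D i k) (hD : 0 < D)
    (i k : Fin (n + 1)) (hik : i ≠ k) : HasTopVertex (pyramid γ D) D i k := by
  induction k using Fin.cases with
  | zero => exact hasTopVertex_pyramid_zero i
  | succ k =>
    induction i using Fin.cases with
    | zero => exact hasTopVertex_comm (hasTopVertex_pyramid_zero _)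
    | succ i =>
      exact (hasTopVertex_pyramid_succ_iff hD i k).2 (htop i k fun h => hik (by rw [h]))

/-- The apex is a pure top power of the new variable, so the new coordinate point is not a zero. -/
lemma encard_pyramid_top (hD : 0 < D) :
    {i | ¬ HasTopVertex (pyramid γ D) D i i}.encard = {i | ¬ HasTopVertex γ D i i}.encard := by
  rw [← (Fin.succ_injective n).encard_image]
  congr 1
  ext i
  induction i using Fin.cases with
  | zero =>
    simp only [Set.mem_ofPred_eq, hasTopVertex_pyramid_zero, not_true_eq_false, Set.mem_image,
      false_iff]
    rintro ⟨k, -, hk⟩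
    exact Fin.succ_ne_zero k hk
  | succ i =>
    simp [hasTopVertex_pyramid_succ_iff hD, (Fin.succ_injective n).eq_iff]

/-- A simplex with finitely many zeros in affine space and `k` at infinity. -/
def HasFiniteModel (n : ℕ) (C : Prop) (k : ℕ∞) : Prop :=
  ∃ (γ : Fin (n + 1) → Fin n → ℕ) (D : ℕ), IsLatticeSimplex γ D ∧ ((∃ j, γ j = 0) ↔ C) ∧
    HasAxisVertices γ ∧ (∀ i k, i ≠ k → HasTopVertex γ D i k) ∧
    {i | ¬ HasTopVertex γ D i i}.encard = k

/-- A simplex with finitely many zeros in affine space and infinitely many at infinity. -/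
def HasInfiniteModel (n : ℕ) (C : Prop) : Prop :=
  ∃ (γ : Fin (n + 1) → Fin n → ℕ) (D : ℕ), IsLatticeSimplex γ D ∧ ((∃ j, γ j = 0) ↔ C) ∧
    HasAxisVertices γ ∧ ∃ i k, i ≠ k ∧ ¬ HasTopVertex γ D i k

lemma HasFiniteModel.of_le {n₀ : ℕ} {C : Prop} {k : ℕ∞} (h : HasFiniteModel n₀ C k)
    (hn : n₀ ≤ n) : HasFiniteModel n C k := by
  induction n, hn using Nat.le_induction with
  | base => exact h
  | succ n _ ih =>
    obtain ⟨γ, D, h1, h2, h3, h4, h5⟩ := ih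
    exact ⟨pyramid γ D, D, h1.pyramid, (exists_pyramid_eq_zero_iff h1.pos).trans h2,
      hasAxisVertices_pyramid h3, pyramid_top_pairs h4 h1.pos,
      (encard_pyramid_top h1.pos).trans h5⟩

lemma HasInfiniteModel.of_le {n₀ : ℕ} {C : Prop} (h : HasInfiniteModel n₀ C)
    (hn : n₀ ≤ n) : HasInfiniteModel n C := by
  induction n, hn using Nat.le_induction with
  | base => exact h
  | succ n _ ih =>
    obtain ⟨γ, D, h1, h2, h3, i, k, hik, h4⟩ := ih
    exact ⟨pyramid γ D, D, h1.pyramid, (exists_pyramid_eq_zero_iff h1.pos).trans h2,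
      hasAxisVertices_pyramid h3, i.succ, k.succ, fun h => hik (Fin.succ_injective n h),
      mt (hasTopVertex_pyramid_succ_iff h1.pos i k).1 h4⟩

lemma HasFiniteModel.occurs {C : Prop} {k : ℕ∞} (h : HasFiniteModel n C k) (hn : 0 < n) :
    Occurs n (fun d f _ => (HasConstantTerm f ↔ C) ∧ (affineZeros f).Finite ∧
      (zerosAtInfinity (homogenization d f)).encard = k) := by
  obtain ⟨γ, D, h1, h2, h3, h4, h5⟩ := h
  -- Any positive weights with even sum serve, since the parity of β plays no role here.
  refine h1.occurs hn (m := fun _ => 2) (fun _ => two_pos) (by simp) ?_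
  intro M d f w c b p K ε hM hd hf h
  exact ⟨h.hasConstantTerm_iff.trans ((exists_dilate_eq_zero_iff hM).trans h2),
    h.finite_affineZeros hn ((hasAxisExp_dilate_iff hM).2 h3),
    (h.encard_zerosAtInfinity_dilate hn hM hd hf h4).trans h5⟩

lemma HasInfiniteModel.occurs {C : Prop} (h : HasInfiniteModel n C) (hn : 0 < n) :
    Occurs n (fun d f _ => (HasConstantTerm f ↔ C) ∧ (affineZeros f).Finite ∧
      (zerosAtInfinity (homogenization d f)).Infinite) := by
  obtain ⟨γ, D, h1, h2, h3, h4⟩ := h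
  refine h1.occurs hn (m := fun _ => 2) (fun _ => two_pos) (by simp) ?_
  intro M d f w c b p K ε hM hd hf h
  exact ⟨h.hasConstantTerm_iff.trans ((exists_dilate_eq_zero_iff hM).trans h2),
    h.finite_affineZeros hn ((hasAxisExp_dilate_iff hM).2 h3),
    h.infinite_zerosAtInfinity_dilate hn hM hd hf h4⟩

lemma hasFiniteModel_of_triangle {γ : Fin (2 + 1) → Fin 2 → ℕ} {C : Prop} {k : ℕ}
    (hγ : IsLatticeSimplex γ D) (hC : (∃ j, γ j = 0) ↔ C) (hax : HasAxisVertices γ)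
    (hk : topCount γ D = k) : HasFiniteModel 2 C k := by
  refine ⟨γ, D, hγ, hC, hax, fun i k hik => ?_, ?_⟩
  · obtain ⟨j, hj⟩ := hγ.degree_eq
    exact ⟨j, hj, fun m h1 h2 => by omega⟩
  · rw [← hk, ← Set.encard_coe_eq_coe_finsetCard]
    simp

/-- The extremal case C(3,2) = 3 of the count: one top vertex for each pair of coordinates and no
pure top power. -/
lemma hasFiniteModel_three : HasFiniteModel 3 True 3 := by
  refine ⟨![![0, 0, 0], ![1, 1, 0], ![0, 1, 1], ![1, 0, 1]], 2, ⟨fun u hu hs => ?_, by decide,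
    by decide, by decide⟩, by decide, by decide, by decide, ?_⟩
  · have h0 := hs 0
    have h1 := hs 1
    have h2 := hs 2
    simp [Fin.sum_univ_four] at h0 h1 h2 hu
    funext j
    fin_cases j <;> simp <;> linarith
  · rw [show {i | ¬ HasTopVertex ![![0, 0, 0], ![1, 1, 0], ![0, 1, 1], ![1, 0, 1]] 2 i i} =
      ((Finset.univ : Finset (Fin 3)) : Set (Fin 3)) by
        ext i; simp only [Set.mem_ofPred_eq, Finset.coe_univ, Set.mem_univ, iff_true]
        revert i; decide, Set.encard_coe_eq_coe_finsetCard]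
    rfl

/-- The only top vertex is on the first axis, so the line at infinity joining the other two
coordinate points consists of zeros. The variant without constant term works alike. -/
lemma hasInfiniteModel_constant : HasInfiniteModel 3 True := by
  refine ⟨![![0, 0, 0], ![2, 0, 0], ![0, 1, 0], ![0, 0, 1]], 2, ⟨fun u hu hs => ?_, by decide,
    by decide, by decide⟩, by decide, by decide, by decide⟩
  have h0 := hs 0
  have h1 := hs 1
  have h2 := hs 2
  simp [Fin.sum_univ_four] at h0 h1 h2 hu
  funext j
  fin_cases j <;> simp <;> linarith

lemma hasInfiniteModel_no_constant : HasInfiniteModel 3 False := by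
  refine ⟨![![2, 0, 0], ![1, 0, 0], ![0, 1, 0], ![0, 0, 1]], 2, ⟨fun u hu hs => ?_, by decide,
    by decide, by decide⟩, by decide, by decide, by decide⟩
  have h0 := hs 0
  have h1 := hs 1
  have h2 := hs 2
  simp [Fin.sum_univ_four] at h0 h1 h2 hu
  funext j
  fin_cases j <;> simp <;> linarith

lemma hasFiniteModel_constant (hn : 2 < n) (k : ℕ) (hk : k ≤ 3) : HasFiniteModel n True k := by
  interval_cases k
  · exact (hasFiniteModel_of_triangle (γ := ![![0, 0], ![1, 0], ![0, 1]]) (D := 1)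
      (isLatticeSimplex_of_det (by decide) (by decide) (by decide) (by decide))
      (by decide) (by decide) (by decide)).of_le hn.le
  · exact (hasFiniteModel_of_triangle (γ := ![![0, 0], ![2, 0], ![0, 1]]) (D := 2)
      (isLatticeSimplex_of_det (by decide) (by decide) (by decide) (by decide))
      (by decide) (by decide) (by decide)).of_le hn.le
  · exact (hasFiniteModel_of_triangle (γ := ![![0, 0], ![1, 1], ![1, 0]]) (D := 2)
      (isLatticeSimplex_of_det (by decide) (by decide) (by decide) (by decide))
      (by decide) (by decide) (by decide)).of_le hn.le
  · exact hasFiniteModel_three.of_le hn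

lemma hasFiniteModel_no_constant (hn : 2 < n) (k : ℕ) (hk : k ≤ 2) :
    HasFiniteModel n False k := by
  interval_cases k
  · exact (hasFiniteModel_of_triangle (γ := ![![2, 0], ![0, 2], ![1, 0]]) (D := 2)
      (isLatticeSimplex_of_det (by decide) (by decide) (by decide) (by decide))
      (by decide) (by decide) (by decide)).of_le hn.le
  · exact (hasFiniteModel_of_triangle (γ := ![![1, 0], ![2, 0], ![0, 1]]) (D := 2)
      (isLatticeSimplex_of_det (by decide) (by decide) (by decide) (by decide))
      (by decide) (by decide) (by decide)).of_le hn.le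
  · exact (hasFiniteModel_of_triangle (γ := ![![1, 1], ![1, 0], ![0, 1]]) (D := 2)
      (isLatticeSimplex_of_det (by decide) (by decide) (by decide) (by decide))
      (by decide) (by decide) (by decide)).of_le hn.le

end

end CircuitZeros

end

open CircuitZeros in
theorem mainTheorem2 :
    -- bivariate case
    (∀ (d : ℕ) (f : MvPolynomial (Fin 2) ℝ) (r : ℕ) (α : Fin (r + 1) → Fin 2 →₀ ℕ)
        (β : Fin 2 →₀ ℕ), IsBoundaryCircuit d f r α β →
      -- with a constant term
      (HasConstantTerm f → ¬ IsDegenerate f →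
        (IsEvenExp β → (affineZeros f).encard = 4 ∧
          (projZeros (homogenization d f)).encard ∈ ({4, 5, 6} : Set ℕ∞)) ∧
        (¬ IsEvenExp β → (affineZeros f).encard = 2 ∧
          (projZeros (homogenization d f)).encard ∈ ({2, 3, 4} : Set ℕ∞))) ∧
      -- without a constant term
      (¬ HasConstantTerm f →
        (IsEvenExp β →
          ((affineZeros f).encard = 5 ∧
            (projZeros (homogenization d f)).encard ∈ ({5, 6, 7} : Set ℕ∞)) ∨
          ((affineZeros f).encard = ⊤ ∧ (projZeros (homogenization d f)).encard = ⊤)) ∧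
        (¬ IsEvenExp β →
          ((affineZeros f).encard = 3 ∧
            (projZeros (homogenization d f)).encard ∈ ({3, 4, 5} : Set ℕ∞)) ∨
          ((affineZeros f).encard = ⊤ ∧ (projZeros (homogenization d f)).encard = ⊤))) ∧
      -- at most two zeros at infinity
      ((affineZeros f).Finite → (zerosAtInfinity (homogenization d f)).encard ≤ 2)) ∧
    -- all the cases of the bivariate case occur
    (∀ k : ℕ, k ≤ 2 →
      Occurs 2 (fun d f β => HasConstantTerm f ∧ IsEvenExp β ∧
        (projZeros (homogenization d f)).encard = 4 + k) ∧
      Occurs 2 (fun d f β => HasConstantTerm f ∧ ¬ IsEvenExp β ∧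
        (projZeros (homogenization d f)).encard = 2 + k) ∧
      Occurs 2 (fun d f β => ¬ HasConstantTerm f ∧ IsEvenExp β ∧
        (projZeros (homogenization d f)).encard = 5 + k) ∧
      Occurs 2 (fun d f β => ¬ HasConstantTerm f ∧ ¬ IsEvenExp β ∧
        (projZeros (homogenization d f)).encard = 3 + k)) ∧
    Occurs 2 (fun _ f β => ¬ HasConstantTerm f ∧ IsEvenExp β ∧ (affineZeros f).Infinite) ∧
    Occurs 2 (fun _ f β => ¬ HasConstantTerm f ∧ ¬ IsEvenExp β ∧ (affineZeros f).Infinite) ∧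
    -- general case
    (∀ n : ℕ, 2 < n →
      (∀ (d : ℕ) (f : MvPolynomial (Fin n) ℝ) (r : ℕ) (α : Fin (r + 1) → Fin n →₀ ℕ)
          (β : Fin n →₀ ℕ), IsBoundaryCircuit d f r α β →
        (projZeros (homogenization d f)).encard =
          (affineZeros f).encard + (zerosAtInfinity (homogenization d f)).encard ∧
        (HasConstantTerm f →
          (zerosAtInfinity (homogenization d f)).encard ≤ 3 ∨
          (zerosAtInfinity (homogenization d f)).Infinite) ∧
        (¬ HasConstantTerm f →
          (zerosAtInfinity (homogenization d f)).encard ≤ 2 ∨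
          (zerosAtInfinity (homogenization d f)).Infinite ∨
          (affineZeros f).Infinite)) ∧
      -- all the cases of the general case occur
      (∀ k : ℕ, k ≤ 3 → Occurs n (fun d f _ => HasConstantTerm f ∧ (affineZeros f).Finite ∧
        (zerosAtInfinity (homogenization d f)).encard = k)) ∧
      Occurs n (fun d f _ => HasConstantTerm f ∧ (affineZeros f).Finite ∧
        (zerosAtInfinity (homogenization d f)).Infinite) ∧
      (∀ k : ℕ, k ≤ 2 → Occurs n (fun d f _ => ¬ HasConstantTerm f ∧ (affineZeros f).Finite ∧
        (zerosAtInfinity (homogenization d f)).encard = k)) ∧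
      Occurs n (fun d f _ => ¬ HasConstantTerm f ∧ (affineZeros f).Finite ∧
        (zerosAtInfinity (homogenization d f)).Infinite)) := by
  refine ⟨fun d f r α β hf => bivariate_zeros hf, bivariate_occurs, bivariate_occurs_infinite.1,
    bivariate_occurs_infinite.2, fun n hn => ⟨fun d f r α β hf => multivariate_zeros hn hf,
      fun k hk => ?_, ?_, fun k hk => ?_, ?_⟩⟩
  · simpa using (hasFiniteModel_constant hn k hk).occurs (by omega)
  · simpa using (hasInfiniteModel_constant.of_le hn).occurs (by omega)
  · simpa using (hasFiniteModel_no_constant hn k hk).occurs (by omega)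
  · simpa using (hasInfiniteModel_no_constant.of_le hn).occurs (by omega)
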